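/- A simple stochastic game (SSG) is a finite directed graph whose nodes are partitioned into max-, min-, random and sink nodes. Every node has outdegree at least one, and the only arc leaving a sink is a loop. Each sink has a rational value, and each random node has a rational probability distribution on its outneighbours (arbitrary outdegree). Strategies $\sigma$ (max) and $\tau$ (min) are pure and stationary. $\mathrm{Val}_{\sigma,\tau}(x)$ is the expected value of the sink reached by the random play from $x$, a play that reaches no sink having value $0$. The optimal value is $\mathrm{Val}_{*,*}(x)=\max_\sigma\min_\tau \mathrm{Val}_{\sigma,\tau}(x)=\min_\tau\max_\sigma \mathrm{Val}_{\sigma,\tau}(x)$. Strategies $(\sigma,\tau)$ are optimal if $\mathrm{Val}_{\sigma,\tau}(x)=\mathrm{Val}_{*,*}(x)$ for every $x$ and each of them ensures this value against every strategy of the opponent. The game is in canonical form if max has a strategy that reaches a sink with probability one, from every node and against every strategy of min, and if only random nodes have arcs to sinks (apart from the loops of the sinks). Let $G$ be an SSG in canonical form with random nodes $r_1,\dots,r_k$ and nonnegative sink values. For a total order $t$ on $[1,k]$, the game $G[t]$ is obtained from $G$ by adding a min-node $i$ (a control node) for each $i\in[1,k]$, redirecting to $i$ all arcs that enter $r_i$,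 and adding the arc $(i,r_i)$ and the arcs $(i,j)$ for all $j\ne i$ with $(i,j)\in t$. $\mathrm{Val}[t]$ is the vector of optimal values of $G[t]$. The control node $i$ is constrained if $\mathrm{Val}[t](i)<\mathrm{Val}[t](r_i)$. Its value interval is the set of control nodes $j$ with $\mathrm{Val}[t](j)=\mathrm{Val}[t](i)$. Pivoting on $i$ moves $i$ in $t$ just after the last element of its value interval. A pair $(\sigma,\tau)$ of strategies of $G$ is $t$-forcing if $\sigma$ and $\tau$ are optimal in the game obtained from $G[t]$ by removing the sinks and random nodes and turning each control node into a sink whose value is its rank in $t$. The algorithm starts from an arbitrary total order $t$ on $[1,k]$ and draws once, uniformly at random, a total order $\Theta$ on the $k(k-1)/2$ unordered pairs $\{i,j\}$ of control nodes. While $G[t]$ has a constrained control node, it replaces $t$ by the order obtained by pivoting on the following node: enumerate the pairs in the order $\Theta$, and take the first constrained $i$ for which all pairs $\{i,j\}$, with $j$ after $i$ in $t$ and in the value interval of $i$, have been enumerated. When no control node is constrained, it returns any pair of $t$-forcing strategies for the current $t$. Theorem. For every initial order and every $\Theta$ the algorithm terminates, a pair of forcing strategies to be returned exists, and every returned pair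 of strategies is optimal in $G$. The expected number of pivot steps, over the choice of $\Theta$, is at most $e^{\sqrt2\,k}$. -/

import Mathlib

open MeasureTheory ProbabilityTheory

noncomputable section

/-! ## Simple stochastic games -/

/-- The four sorts of nodes. -/
inductive NodeKind where
  | max | min | ran | sink
  deriving DecidableEq

/-- A simple stochastic game on the finite node set `V`. Only the values of `sinkVal` at sinks and
the rows of `prob` at random nodes are meaningful. -/
structure SSG (V : Type*) [Fintype V] where
  kind : V → NodeKind
  arc : V → V → Prop
  sinkVal : V → ℚ
  prob : V → V → ℚ
  exists_arc : ∀ x, ∃ y, arc x y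
  sink_arc : ∀ x y, kind x = .sink → (arc x y ↔ y = x)
  prob_nonneg : ∀ x y, kind x = .ran → 0 ≤ prob x y
  prob_sum : ∀ x, kind x = .ran → ∑ y, prob x y = 1
  prob_arc : ∀ x y, kind x = .ran → prob x y ≠ 0 → arc x y

namespace SSG

variable {V : Type*} [Fintype V] (G : SSG V)

/-- Pure stationary strategies of player max. -/
abbrev MaxStrategy : Type _ := (x : {x : V // G.kind x = .max}) → {y : V // G.arc x y}

/-- Pure stationary strategies of player min. -/
abbrev MinStrategy : Type _ := (x : {x : V // G.kind x = .min}) → {y : V // G.arc x y}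

variable {G}

theorem sum_ofReal_prob (x : V) (h : G.kind x = .ran) :
    ∑ y, ENNReal.ofReal ((G.prob x y : ℚ) : ℝ) = 1 := by
  rw [← ENNReal.ofReal_sum_of_nonneg (fun y _ => by exact_mod_cast G.prob_nonneg x y h)]
  have : ∑ y, ((G.prob x y : ℚ) : ℝ) = 1 := by exact_mod_cast G.prob_sum x h
  simp [this]

/-- The law of the node that follows `x` when the players use `σ` and `τ`. -/
def next (σ : G.MaxStrategy) (τ : G.MinStrategy) (x : V) : PMF V :=
  match h : G.kind x with
  | .max => PMF.pure (σ ⟨x, h⟩ : V)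
  | .min => PMF.pure (τ ⟨x, h⟩ : V)
  | .ran => PMF.ofFintype (fun y => ENNReal.ofReal ((G.prob x y : ℚ) : ℝ)) (sum_ofReal_prob x h)
  | .sink => PMF.pure x

/-- The transition kernel from histories `x₀, …, xₙ` to the next node; the node set carries the
discrete σ-algebra. -/
def stepKernel (σ : G.MaxStrategy) (τ : G.MinStrategy) (n : ℕ) :
    letI : MeasurableSpace V := ⊤
    Kernel (Finset.Iic n → V) V :=
  letI : MeasurableSpace V := ⊤
  haveI : MeasurableSingletonClass V := ⟨fun _ => trivial⟩
  Kernel.ofFunOfCountable fun hist => (next σ τ (hist ⟨n, Finset.mem_Iic.2 le_rfl⟩)).toMeasure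

instance (σ : G.MaxStrategy) (τ : G.MinStrategy) (n : ℕ) :
    letI : MeasurableSpace V := ⊤
    IsMarkovKernel (stepKernel σ τ n) :=
  letI : MeasurableSpace V := ⊤
  ⟨fun hist => PMF.toMeasure.isProbabilityMeasure
    (next σ τ (hist ⟨n, Finset.mem_Iic.2 le_rfl⟩))⟩

/-- The probability measure on plays `x₀, x₁, …` started at `x` and consistent with `σ`, `τ`. -/
def playMeasure (σ : G.MaxStrategy) (τ : G.MinStrategy) (x : V) :
    letI : MeasurableSpace V := ⊤
    Measure (ℕ → V) :=
  letI : MeasurableSpace V := ⊤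
  Kernel.traj (X := fun _ => V) (stepKernel σ τ) 0 (fun _ => x)

variable (G)

open Classical in
/-- The value of a play: the value of the sink that it reaches, and `0` if it reaches none. -/
def payoff (ω : ℕ → V) : ℝ :=
  if h : ∃ n, G.kind (ω n) = .sink then (G.sinkVal (ω (Nat.find h)) : ℝ) else 0

variable {G}

/-- `Val_{σ,τ}(x)`. -/
def val (σ : G.MaxStrategy) (τ : G.MinStrategy) (x : V) : ℝ :=
  letI : MeasurableSpace V := ⊤
  ∫ ω, G.payoff ω ∂(playMeasure σ τ x)

/-- `Val_{σ,*}(x)`, what `σ` ensures (a minimum over finitely many strategies). -/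
def valMax (σ : G.MaxStrategy) (x : V) : ℝ := ⨅ τ : G.MinStrategy, val σ τ x

/-- `Val_{*,τ}(x)`, what `τ` ensures (a maximum over finitely many strategies). -/
def valMin (τ : G.MinStrategy) (x : V) : ℝ := ⨆ σ : G.MaxStrategy, val σ τ x

variable (G)

/-- `max_σ Val_{σ,*}(x)`, the optimal value `Val_{*,*}(x)`. -/
def value (x : V) : ℝ := ⨆ σ : G.MaxStrategy, valMax σ x

/-- `min_τ Val_{*,τ}(x)`. -/
def upperValue (x : V) : ℝ := ⨅ τ : G.MinStrategy, valMin τ x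

variable {G}

/-- `σ` is an optimal strategy of player max. -/
def IsMaxOptimal (σ : G.MaxStrategy) : Prop := ∀ x, valMax σ x = G.value x

/-- `τ` is an optimal strategy of player min. -/
def IsMinOptimal (τ : G.MinStrategy) : Prop := ∀ x, valMin τ x = G.upperValue x

/-- `σ`, `τ` are optimal strategies: together they realise the optimal value
`max min = min max` at every node, and each of them ensures it against every opponent. -/
def AreOptimal (σ : G.MaxStrategy) (τ : G.MinStrategy) : Prop :=
  (∀ x, val σ τ x = G.value x ∧ val σ τ x = G.upperValue x) ∧ IsMaxOptimal σ ∧ IsMinOptimal τ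

/-- `σ` is stopping: against every strategy of min, almost every play reaches a sink. -/
def IsStopping (σ : G.MaxStrategy) : Prop :=
  letI : MeasurableSpace V := ⊤
  ∀ (τ : G.MinStrategy) (x : V), ∀ᵐ ω ∂(playMeasure σ τ x), ∃ n, G.kind (ω n) = .sink

variable (G)

/-- Canonical form: max has a stopping strategy, and no max- or min-node has an arc to a sink. -/
def IsCanonical : Prop :=
  (∃ σ : G.MaxStrategy, IsStopping σ) ∧
    ∀ x y, (G.kind x = .max ∨ G.kind x = .min) → G.arc x y → G.kind y ≠ .sink

/-- The random nodes; they also index the control nodes of the modified games. -/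
abbrev Ran : Type _ := {x : V // G.kind x = .ran}

end SSG

/-! ## Total orders and orders on pairs -/

/-- A total order, seen as a set of couples: `rel i j` means that `(i, j)` belongs to it. -/
structure TotalOrder (ι : Type*) where
  rel : ι → ι → Prop
  refl : ∀ i, rel i i
  trans : ∀ i j l, rel i j → rel j l → rel i l
  antisymm : ∀ i j, rel i j → rel j i → i = j
  total : ∀ i j, rel i j ∨ rel j i

namespace TotalOrder

variable {ι : Type*}

/-- The rank of `i`: the number of elements lower than or equal to `i`. -/
def rank (t : TotalOrder ι) (i : ι) : ℕ := Nat.card {j // t.rel j i}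

/-- `j` is lower than or equal to some element that has the same value as `i`, i.e. `j` is not
after the end of the value interval of `i`. -/
def upToInterval (t : TotalOrder ι) (v : ι → ℝ) (i j : ι) : Prop := ∃ l, v l = v i ∧ t.rel j l

/-- The pivot operation on `i`, for the values `v`: move `i` just after the end of its value
interval, and keep the relative order of all the other elements. -/
def pivot (t : TotalOrder ι) (v : ι → ℝ) (i : ι) : TotalOrder ι where
  rel a b := (a = i ∧ (b = i ∨ ¬ t.upToInterval v i b)) ∨
    (a ≠ i ∧ b = i ∧ t.upToInterval v i a) ∨ (a ≠ i ∧ b ≠ i ∧ t.rel a b)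
  refl a := by
    by_cases ha : a = i
    · exact Or.inl ⟨ha, Or.inl ha⟩
    · exact Or.inr (Or.inr ⟨ha, ha, t.refl a⟩)
  trans a b c := by
    have up : ∀ x y, t.rel x y → t.upToInterval v i y → t.upToInterval v i x :=
      fun x y h ⟨l, hl, hy⟩ => ⟨l, hl, t.trans _ _ _ h hy⟩
    have down : ∀ x y, t.upToInterval v i x → ¬ t.upToInterval v i y → t.rel x y := by
      rintro x y ⟨l, hl, hx⟩ hy
      rcases t.total y l with h | h
      · exact absurd ⟨l, hl, h⟩ hy
      · exact t.trans _ _ _ hx h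
    rintro (⟨ha, hb⟩ | ⟨ha, hb, h⟩ | ⟨ha, hb, h⟩) (⟨hb', hc⟩ | ⟨hb', hc, h'⟩ | ⟨hb', hc, h'⟩)
    · exact Or.inl ⟨ha, hc⟩
    · exact Or.inl ⟨ha, Or.inl hc⟩
    · exact Or.inl ⟨ha, Or.inr fun hu => (hb.resolve_left hb') (up _ _ h' hu)⟩
    · rcases hc with hc | hc
      · exact Or.inr (Or.inl ⟨ha, hc, h⟩)
      · by_cases hci : c = i
        · exact Or.inr (Or.inl ⟨ha, hci, h⟩)
        · exact Or.inr (Or.inr ⟨ha, hci, down _ _ h hc⟩)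
    · exact absurd hb hb'
    · exact absurd hb hb'
    · exact absurd hb' hb
    · exact Or.inr (Or.inl ⟨ha, hc, up _ _ h h'⟩)
    · exact Or.inr (Or.inr ⟨ha, hc, t.trans _ _ _ h h'⟩)
  antisymm a b := by
    rintro (⟨ha, hb⟩ | ⟨ha, hb, h⟩ | ⟨ha, hb, h⟩) (⟨hb', hc⟩ | ⟨hb', hc, h'⟩ | ⟨hb', hc, h'⟩)
    · exact ha.trans hb'.symm
    · exact absurd h' (hb.resolve_left hb')
    · exact absurd ha hc
    · exact absurd h (hc.resolve_left ha)
    · exact absurd hb hb'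
    · exact absurd hb hb'
    · exact absurd hb' hb
    · exact absurd hc ha
    · exact t.antisymm _ _ h h'
  total a b := by
    by_cases ha : a = i <;> by_cases hb : b = i
    · exact Or.inl (Or.inl ⟨ha, Or.inl hb⟩)
    · by_cases hu : t.upToInterval v i b
      · exact Or.inr (Or.inr (Or.inl ⟨hb, ha, hu⟩))
      · exact Or.inl (Or.inl ⟨ha, Or.inr hu⟩)
    · by_cases hu : t.upToInterval v i a
      · exact Or.inl (Or.inr (Or.inl ⟨ha, hb, hu⟩))
      · exact Or.inr (Or.inl ⟨hb, Or.inr hu⟩)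
    · exact (t.total a b).imp (fun h => Or.inr (Or.inr ⟨ha, hb, h⟩))
        (fun h => Or.inr (Or.inr ⟨hb, ha, h⟩))

end TotalOrder

/-- The unordered pairs `{i, j}` with `i ≠ j`. -/
abbrev Pairs (ι : Type*) : Type _ := {e : Sym2 ι // ¬ e.IsDiag}

/-- The pair `{i, j}`. -/
def pairOf {ι : Type*} {i j : ι} (h : i ≠ j) : Pairs ι := ⟨s(i, j), by simpa using h⟩

/-- A total order `Θ` on the pairs, given by its enumeration in ascending order: `Θ e` is the
position of `e`. -/
abbrev PairOrder (ι : Type*) : Type _ := Pairs ι ≃ Fin (Nat.card (Pairs ι))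

namespace SSG

variable {V : Type*} [Fintype V] (G : SSG V)

/-! ## The modified game -/

/-- Every arc that enters a random node `r` is redirected to the control node of `r`. -/
def redirect (y : V) : V ⊕ G.Ran :=
  if h : G.kind y = .ran then .inr ⟨y, h⟩ else .inl y

/-- The modified game `G[p]`: a copy of `G`, with an additional min-node (control node) for each
random node `i`, which intercepts the arcs entering `i`, and has an arc to the random node `i`
and to each control node `j ≠ i` with `(i, j) ∈ p`. -/
def modified (p : G.Ran → G.Ran → Prop) : SSG (V ⊕ G.Ran) where
  kind z := match z with
    | .inl x => G.kind x
    | .inr _ => .min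
  arc z w := match z with
    | .inl x => ∃ y, G.arc x y ∧ w = G.redirect y
    | .inr i => w = .inl i.1 ∨ ∃ j, j ≠ i ∧ p i j ∧ w = .inr j
  sinkVal z := match z with
    | .inl x => G.sinkVal x
    | .inr _ => 0
  prob z w := match z, w with
    | .inl x, .inl y => if G.kind y = .ran then 0 else G.prob x y
    | .inl x, .inr j => G.prob x j.1
    | .inr _, _ => 0
  exists_arc := by
    rintro (x | i)
    · obtain ⟨y, hy⟩ := G.exists_arc x
      exact ⟨_, y, hy, rfl⟩
    · exact ⟨_, Or.inl rfl⟩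
  sink_arc := by
    rintro (x | i) w h
    · have hr : G.redirect x = .inl x := by
        have h' : G.kind x = .sink := h
        simp [redirect, h']
      constructor
      · rintro ⟨y, hy, rfl⟩
        rw [(G.sink_arc x y h).1 hy, hr]
      · rintro rfl
        exact ⟨x, (G.sink_arc x x h).2 rfl, hr.symm⟩
    · cases h
  prob_nonneg := by
    rintro (x | i) (y | j) h
    · have := G.prob_nonneg x y h
      dsimp only
      split_ifs <;> simp [this]
    · exact G.prob_nonneg x j.1 h
    · cases h
    · cases h
  prob_sum := by
    rintro (x | i) h
    · have key : ∀ f : V → ℚ, ∑ j : G.Ran, f j.1 = ∑ y, if G.kind y = .ran then f y else 0 := by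
        intro f
        rw [← Finset.sum_filter]
        exact (Finset.sum_subtype _ (by simp) f).symm
      rw [Fintype.sum_sum_type, key, ← Finset.sum_add_distrib, ← G.prob_sum x h]
      refine Finset.sum_congr rfl fun y _ => ?_
      by_cases hy : G.kind y = .ran <;> simp [hy]
    · cases h
  prob_arc := by
    rintro (x | i) (y | j) h hp
    · have hy : G.kind y ≠ .ran := fun hy => hp (by simp [hy])
      refine ⟨y, G.prob_arc x y h (by simpa [hy] using hp), by simp [redirect, hy]⟩
    · exact ⟨j.1, G.prob_arc x j.1 h hp, by simp [redirect, j.2]⟩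
    · cases h
    · cases h

/-! ## Forcing strategies -/

/-- The game without random nodes obtained from `G[t]` by removing the sinks and the random nodes
and then turning each control node into a sink whose value is its rank in `t`. The removed nodes
are kept as isolated sinks: in canonical form no other node has an arc to them. -/
def forcingGame (t : TotalOrder G.Ran) : SSG (V ⊕ G.Ran) where
  kind z := match z with
    | .inl x => if G.kind x = .ran then .sink else G.kind x
    | .inr _ => .sink
  arc z w := match z with
    | .inl x => if G.kind x = .max ∨ G.kind x = .min then ∃ y, G.arc x y ∧ w = G.redirect y
        else w = .inl x
    | .inr i => w = .inr i
  sinkVal z := match z with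
    | .inl _ => 0
    | .inr i => t.rank i
  prob _ _ := 0
  exists_arc := by
    rintro (x | i)
    · by_cases h : G.kind x = .max ∨ G.kind x = .min
      · obtain ⟨y, hy⟩ := G.exists_arc x
        exact ⟨G.redirect y, by simp only [h, if_true]; exact ⟨y, hy, rfl⟩⟩
      · exact ⟨.inl x, by simp only [h, if_false]⟩
    · exact ⟨_, rfl⟩
  sink_arc := by
    rintro (x | i) w h
    · have h' : ¬ (G.kind x = .max ∨ G.kind x = .min) := by
        rintro (hx | hx) <;> simp [hx] at h
      simp only [h', if_false]
    · exact Iff.rfl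
  prob_nonneg := by simp
  prob_sum := by
    rintro (x | i) h
    · dsimp only at h
      split_ifs at h
      contradiction
    · cases h
  prob_arc := by simp

variable {G}

/-- A strategy of max in `G`, seen in the game that defines forcing strategies. -/
def liftMax (t : TotalOrder G.Ran) (σ : G.MaxStrategy) : (G.forcingGame t).MaxStrategy
  | ⟨.inl x, h⟩ =>
    have hx : G.kind x = .max := by
      dsimp only [forcingGame] at h
      split_ifs at h
      exact h
    ⟨G.redirect (σ ⟨x, hx⟩), by
      simp only [forcingGame, hx, true_or, if_true]
      exact ⟨_, (σ ⟨x, hx⟩).2, rfl⟩⟩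
  | ⟨.inr _, h⟩ => nomatch h

/-- A strategy of min in `G`, seen in the game that defines forcing strategies. -/
def liftMin (t : TotalOrder G.Ran) (τ : G.MinStrategy) : (G.forcingGame t).MinStrategy
  | ⟨.inl x, h⟩ =>
    have hx : G.kind x = .min := by
      dsimp only [forcingGame] at h
      split_ifs at h
      exact h
    ⟨G.redirect (τ ⟨x, hx⟩), by
      simp only [forcingGame, hx, or_true, if_true]
      exact ⟨_, (τ ⟨x, hx⟩).2, rfl⟩⟩
  | ⟨.inr _, h⟩ => nomatch h

/-- `σ`, `τ` are `t`-forcing strategies. -/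
def AreForcing (t : TotalOrder G.Ran) (σ : G.MaxStrategy) (τ : G.MinStrategy) : Prop :=
  IsMaxOptimal (liftMax t σ) ∧ IsMinOptimal (liftMin t τ)

variable (G)

/-! ## The algorithm -/

/-- `Val[t]` at the control nodes: their optimal values in `G[t]`. -/
def controlVal (t : TotalOrder G.Ran) (i : G.Ran) : ℝ := (G.modified t.rel).value (.inr i)

/-- The control node `i` is constrained in `G[t]`: its optimal value is lower than that of the
random node `i`. -/
def IsConstrained (t : TotalOrder G.Ran) (i : G.Ran) : Prop :=
  G.controlVal t i < (G.modified t.rel).value (.inl i.1)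

/-- `j` follows `i` in the value interval of `i`, i.e. `G[t]` has an arc from `i` to `j` and both
have the same value. -/
def Follows (t : TotalOrder G.Ran) (i j : G.Ran) : Prop :=
  i ≠ j ∧ t.rel i j ∧ G.controlVal t j = G.controlVal t i

/-- The pivot selection rule: when the arcs between control nodes are removed in the order `Θ`,
`i` is the first constrained control node which is disconnected from all the nodes that follow it
in its value interval. In other words, every constrained `i'` has a pair `{i', j'}`, with `j'`
following `i'` in its interval, that comes in `Θ` no sooner than any such pair `{i, j}` of `i`. -/
def IsSelected (Θ : PairOrder G.Ran) (t : TotalOrder G.Ran) (i : G.Ran) : Prop :=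
  G.IsConstrained t i ∧ ∀ i', G.IsConstrained t i' →
    ∃ (j' : G.Ran) (h' : G.Follows t i' j'), ∀ (j : G.Ran) (h : G.Follows t i j),
      Θ (pairOf h.1) ≤ Θ (pairOf h'.1)

/-- The pivot selection rule is deterministic. -/
theorem IsSelected.unique {G : SSG V} {Θ : PairOrder G.Ran} {t : TotalOrder G.Ran} {i i' : G.Ran}
    (h : G.IsSelected Θ t i) (h' : G.IsSelected Θ t i') : i = i' := by
  obtain ⟨j', hj', h1⟩ := h.2 i' h'.1
  obtain ⟨j, hj, h2⟩ := h'.2 i h.1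
  have e := Θ.injective (le_antisymm (h1 j hj) (h2 j' hj'))
  rcases Sym2.eq_iff.1 (congrArg Subtype.val e) with ⟨e1, _⟩ | ⟨e1, e2⟩
  · exact e1
  · exact absurd (t.antisymm i j hj.2.1 (by rw [e1, e2]; exact hj'.2.1)) hj.1

/-- `G.Run Θ t n t'`: with the order `Θ` on pairs, the loop started from the total order `t`
performs exactly `n` pivots and stops with the total order `t'`, where no control node is
constrained. -/
inductive Run (Θ : PairOrder G.Ran) : TotalOrder G.Ran → ℕ → TotalOrder G.Ran → Prop
  | done (t : TotalOrder G.Ran) (h : ∀ i, ¬ G.IsConstrained t i) : Run Θ t 0 t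
  | pivot (t : TotalOrder G.Ran) (i : G.Ran) (n : ℕ) (t' : TotalOrder G.Ran)
      (hi : G.IsSelected Θ t i) (h : Run Θ (t.pivot (G.controlVal t) i) n t') :
      Run Θ t (n + 1) t'

variable {G}

/-- The algorithm, with the order `Θ` on pairs and started from `t`, can stop after `n` pivots
and return `σ`, `τ`, a couple of forcing strategies for the last total order. -/
def Returns (Θ : PairOrder G.Ran) (t : TotalOrder G.Ran) (n : ℕ)
    (σ : G.MaxStrategy) (τ : G.MinStrategy) : Prop :=
  ∃ t', G.Run Θ t n t' ∧ AreForcing t' σ τ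

end SSG

end

/-!
Three facts carry the proof.

**Values of `G[p]`.** With nonnegative sink values, the value of a pair of strategies is the least
nonnegative superharmonic function above the sink values (`val_le_of_super`), and a subharmonic
function is a lower bound of it unless it is a positive constant on a trap, a set of nodes without
sinks that the play cannot leave (`le_val_of_sub`). This gives determinacy in positional
strategies (`exists_saddle`), and shows that the optimal values of `G[p]` are the least nonnegative
supersolution of the optimality conditions. Hence these values decrease when arcs between control
nodes are added, they are unchanged by the removal of arcs as long as each constrained node keeps an
arc to a node of the same value (`modVal_eq_of_sub`), and a pivot on a constrained node strictly
increases them (`modVal_lt_flip`). The stopping strategy of max is not needed.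

**Forcing strategies.** Let no control node of `G[t]` be constrained. Forcing strategies of min ensure
the values of `G[t]` since these are a nondecreasing function of the forced rank. For max, a trap of
positive value is excluded: from its control node `ρ` of greatest rank, min could return to `ρ` for
ever, whatever max does, and `ρ` would have the value `0` in `G[t]` (`modVal_eq_zero_of_return`).

**The expected number of pivots.** Let `E` be the set of the last pairs of `Θ`. Ignoring the other
pairs gives a run on the orientations of `E`, defined with the games `G[p]` where `p` only orients `E`;
it depends only on the order of the pairs of `E`. As long as `p` is kept, a pair outside `E` can be
reversed only if both its orientations, added to `p`, give more than the value `u` of the previous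
orientation: such a pair is free. When the pair `b` that precedes `E` in `Θ` is taken into account,
each step of the run on `E` becomes a single step, or two steps separated by a reversal of `b`
(`runCost_le_runSplitCost`). In the latter case `b` is free and free no more afterwards, and in the
second step the pairs `c` that are still free have `Val[p + b] < Val[p + c]` for the first orientation
of `b` and both orientations of `c`, which is a strict partial order on the free pairs. Given `E` and
its order, the pair `b` is uniform among the others. So if a step with `n` free pairs is given the
weight `facetBound n = ∑ₖ C(n, k) / k!`, where
`facetBound (n + 1) = facetBound n + (facetBound 0 + ⋯ + facetBound n) / (n + 1)`, then the expected
weight of the run does not increase with `E` (`sum_levelCost_le`). It is at most `facetBound m`, with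
`m = k (k - 1) / 2`, for empty `E`; for the set of all pairs, no pair is free and it is the number of
orders visited. Finally, `facetBound m ≤ exp (2 √m) ≤ exp (√2 k)`. Termination follows too, the bound
being uniform over the number of steps that are counted.
-/

noncomputable section
namespace SSG

/-! ### Values of a pair of strategies -/

section Plays

variable {V : Type*} [Fintype V] {G : SSG V}

/-- The expectation of `w` at the node that follows `x`, under `σ` and `τ`. -/
def nextExp (σ : G.MaxStrategy) (τ : G.MinStrategy) (w : V → ℝ) (x : V) : ℝ :=
  ∑ y, (next σ τ x y).toReal * w y

variable (σ : G.MaxStrategy) (τ : G.MinStrategy)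

theorem next_max {x : V} (h : G.kind x = .max) : next σ τ x = PMF.pure (σ ⟨x, h⟩ : V) := by
  unfold next
  split <;> first | rfl | (rename_i h'; exact absurd (h.symm.trans h') (by decide))

theorem next_min {x : V} (h : G.kind x = .min) : next σ τ x = PMF.pure (τ ⟨x, h⟩ : V) := by
  unfold next
  split <;> first | rfl | (rename_i h'; exact absurd (h.symm.trans h') (by decide))

theorem next_sink {x : V} (h : G.kind x = .sink) : next σ τ x = PMF.pure x := by
  unfold next
  split <;> first | rfl | (rename_i h'; exact absurd (h.symm.trans h') (by decide))

theorem next_ran_apply {x : V} (h : G.kind x = .ran) (y : V) :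
    next σ τ x y = ENNReal.ofReal ((G.prob x y : ℚ) : ℝ) := by
  unfold next
  split <;> first | rfl | (rename_i h'; exact absurd (h.symm.trans h') (by decide))

theorem sum_pure_toReal (a : V) (w : V → ℝ) :
    ∑ y, ((PMF.pure a : PMF V) y).toReal * w y = w a := by
  classical
  rw [Finset.sum_eq_single a] <;> simp +contextual [PMF.pure_apply]

theorem nextExp_max {x : V} (h : G.kind x = .max) (w : V → ℝ) :
    nextExp σ τ w x = w (σ ⟨x, h⟩) := by
  rw [nextExp, next_max σ τ h, sum_pure_toReal]

theorem nextExp_min {x : V} (h : G.kind x = .min) (w : V → ℝ) :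
    nextExp σ τ w x = w (τ ⟨x, h⟩) := by
  rw [nextExp, next_min σ τ h, sum_pure_toReal]

theorem nextExp_sink {x : V} (h : G.kind x = .sink) (w : V → ℝ) :
    nextExp σ τ w x = w x := by
  rw [nextExp, next_sink σ τ h, sum_pure_toReal]

theorem nextExp_ran {x : V} (h : G.kind x = .ran) (w : V → ℝ) :
    nextExp σ τ w x = ∑ y, (G.prob x y : ℝ) * w y := by
  refine Finset.sum_congr rfl fun y _ => ?_
  rw [next_ran_apply σ τ h, ENNReal.toReal_ofReal (by exact_mod_cast G.prob_nonneg x y h)]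

theorem sum_next (x : V) : ∑ y, (next σ τ x y).toReal = 1 := by
  rw [← ENNReal.toReal_sum fun y _ => PMF.apply_ne_top _ _, ← tsum_fintype (L := .unconditional _),
    PMF.tsum_coe, ENNReal.toReal_one]

theorem nextExp_mono {w w' : V → ℝ} (h : ∀ x, w x ≤ w' x) (x : V) :
    nextExp σ τ w x ≤ nextExp σ τ w' x :=
  Finset.sum_le_sum fun y _ => mul_le_mul_of_nonneg_left (h y) ENNReal.toReal_nonneg

/-- The sink values, extended by `0` to the other nodes. -/
def sinkPayoff (G : SSG V) (x : V) : ℝ := if G.kind x = .sink then (G.sinkVal x : ℝ) else 0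

theorem integral_play_step (x : V) (n : ℕ) (F : V → V → ℝ) :
    letI : MeasurableSpace V := ⊤
    ∫ ω, F (ω n) (ω (n + 1)) ∂(playMeasure σ τ x) =
      ∫ ω, nextExp σ τ (F (ω n)) (ω n) ∂(playMeasure σ τ x) := by
  let _ : MeasurableSpace V := ⊤
  have hV : MeasurableSingletonClass V := ⟨fun _ => trivial⟩
  have hc := Kernel.partialTraj_compProd_eq_map_traj (X := fun _ => V) (κ := stepKernel σ τ)
    (zero_le (a := n)) (x₀ := fun _ => x)
  have hm := Kernel.traj_map_frestrictLe_apply (X := fun _ => V) (κ := stepKernel σ τ) 0 n (fun _ => x)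
  have hF : ∀ H : (Finset.Iic n → V) × V → ℝ, Measurable H := fun H => measurable_of_finite H
  have hF' : ∀ H : (Finset.Iic n → V) → ℝ, Measurable H := fun H => measurable_of_finite H
  let e : Finset.Iic n := ⟨n, Finset.mem_Iic.2 le_rfl⟩
  have h1 : ∫ ω, F (ω n) (ω (n + 1)) ∂(playMeasure σ τ x) =
      ∫ z : (Finset.Iic n → V) × V, F (z.1 e) z.2
        ∂((playMeasure σ τ x).map fun ω => (Preorder.frestrictLe n ω, ω (n + 1))) := by
    rw [integral_map (Measurable.aemeasurable (by fun_prop)) (hF _).aestronglyMeasurable]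
    rfl
  rw [h1, playMeasure, ← hc, Measure.integral_compProd (Integrable.of_finite), ← hm,
    integral_map (Measurable.aemeasurable (by fun_prop)) (hF' _).aestronglyMeasurable]
  refine integral_congr_ae (Filter.Eventually.of_forall fun ω => ?_)
  change ∫ y, F (ω n) y ∂(next σ τ (ω n)).toMeasure = _
  rw [PMF.integral_eq_sum]
  rfl

theorem play_zero (x : V) :
    letI : MeasurableSpace V := ⊤
    ∀ᵐ ω ∂(playMeasure σ τ x), ω 0 = x := by
  let _ : MeasurableSpace V := ⊤
  have hV : MeasurableSingletonClass V := ⟨fun _ => trivial⟩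
  have hm := Kernel.traj_map_frestrictLe_apply (X := fun _ => V) (κ := stepKernel σ τ) 0 0 (fun _ => x)
  have hz : Measurable (Preorder.frestrictLe (π := fun _ : ℕ => V) 0) := by fun_prop
  have : ∀ᵐ z ∂((playMeasure σ τ x).map (Preorder.frestrictLe 0)),
      z ⟨0, Finset.mem_Iic.2 le_rfl⟩ = x := by
    rw [playMeasure, hm, Kernel.partialTraj_self, Kernel.id_apply]
    rw [ae_dirac_eq]
    rfl
  exact ae_of_ae_map hz.aemeasurable this

theorem integral_play (x : V) (n : ℕ) (g : V → ℝ) :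
    letI : MeasurableSpace V := ⊤
    ∫ ω, g (ω n) ∂(playMeasure σ τ x) = (nextExp σ τ)^[n] g x := by
  let _ : MeasurableSpace V := ⊤
  have hP : IsProbabilityMeasure (playMeasure σ τ x) := by unfold playMeasure; infer_instance
  induction n generalizing g with
  | zero =>
    have : ∀ᵐ ω ∂(playMeasure σ τ x), g (ω 0) = g x := by
      filter_upwards [play_zero σ τ x] with ω h
      rw [h]
    rw [integral_congr_ae this]
    simp
  | succ n ih =>
    rw [integral_play_step σ τ x n (fun _ y => g y), Function.iterate_succ_apply, ← ih]

/-- Almost every play stays at a sink once it has reached it. -/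
theorem play_absorbed (x : V) :
    letI : MeasurableSpace V := ⊤
    ∀ᵐ ω ∂(playMeasure σ τ x), ∀ n, G.kind (ω n) = .sink → ω (n + 1) = ω n := by
  classical
  let _ : MeasurableSpace V := ⊤
  have hV : MeasurableSingletonClass V := ⟨fun _ => trivial⟩
  have hP : IsProbabilityMeasure (playMeasure σ τ x) := by unfold playMeasure; infer_instance
  rw [ae_all_iff]
  intro n
  let F : V → V → ℝ := fun a b => if G.kind a = .sink ∧ b ≠ a then 1 else 0
  have h0 : ∫ ω, F (ω n) (ω (n + 1)) ∂(playMeasure σ τ x) = 0 := by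
    rw [integral_play_step]
    refine integral_eq_zero_of_ae (Filter.Eventually.of_forall fun ω => ?_)
    by_cases h : G.kind (ω n) = .sink
    · simp [nextExp_sink σ τ h, F]
    · simp [nextExp, F, h]
  have hmeas : Measurable fun ω : ℕ → V => F (ω n) (ω (n + 1)) := by
    have h2 : Measurable fun z : V × V => F z.1 z.2 := measurable_of_finite _
    exact h2.comp (f := fun ω : ℕ → V => (ω n, ω (n + 1))) (by fun_prop)
  have hle : ∀ a b, 0 ≤ F a b ∧ F a b ≤ 1 := fun a b => by
    simp only [F]; split_ifs <;> norm_num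
  rw [integral_eq_zero_iff_of_nonneg (fun ω => (hle _ _).1)] at h0
  · filter_upwards [h0] with ω h hs
    by_contra hne
    have : F (ω n) (ω (n + 1)) = 1 := if_pos ⟨hs, hne⟩
    have h' : F (ω n) (ω (n + 1)) = 0 := h
    linarith
  · refine Integrable.of_bound hmeas.aestronglyMeasurable 1 (Filter.Eventually.of_forall fun ω => ?_)
    rw [Real.norm_eq_abs, abs_of_nonneg (hle _ _).1]
    exact (hle _ _).2

/-- The value is the limit of the payoffs truncated at time `n`: the truncated payoff of a play
that is absorbed by the sinks is eventually constant. -/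
theorem tendsto_val (x : V) :
    Filter.Tendsto (fun n => (nextExp σ τ)^[n] (sinkPayoff G) x) Filter.atTop
      (nhds (val σ τ x)) := by
  classical
  let _ : MeasurableSpace V := ⊤
  have hV : MeasurableSingletonClass V := ⟨fun _ => trivial⟩
  have hP : IsProbabilityMeasure (playMeasure σ τ x) := by unfold playMeasure; infer_instance
  simp_rw [← integral_play]
  have hmeas : ∀ n, Measurable fun ω : ℕ → V => sinkPayoff G (ω n) := fun n =>
    (measurable_of_finite (sinkPayoff G)).comp (measurable_pi_apply n)
  refine tendsto_integral_of_dominated_convergence (fun _ => ∑ y, |sinkPayoff G y|)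
    (fun n => (hmeas n).aestronglyMeasurable) (integrable_const _)
    (fun n => Filter.Eventually.of_forall fun ω => ?_) ?_
  · exact Finset.single_le_sum (f := fun y => |sinkPayoff G y|) (fun y _ => abs_nonneg _)
      (Finset.mem_univ (ω n))
  · filter_upwards [play_absorbed σ τ x] with ω hω
    refine tendsto_const_nhds.congr' ?_
    by_cases h : ∃ n, G.kind (ω n) = .sink
    · filter_upwards [Filter.eventually_ge_atTop (Nat.find h)] with n hn
      have : ω n = ω (Nat.find h) := by
        induction n, hn using Nat.le_induction with
        | base => rfl
        | succ n hn ih => rw [hω n (by rw [ih]; exact Nat.find_spec h), ih]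
      rw [this, payoff, dif_pos h, sinkPayoff, if_pos (Nat.find_spec h)]
    · refine Filter.Eventually.of_forall fun n => ?_
      have hn : G.kind (ω n) ≠ .sink := fun h' => h ⟨n, h'⟩
      simp only [payoff, dif_neg h, sinkPayoff, if_neg hn]

theorem iterate_nextExp_sink {x : V} (h : G.kind x = .sink) (n : ℕ) (w : V → ℝ) :
    (nextExp σ τ)^[n] w x = w x := by
  induction n with
  | zero => rfl
  | succ n ih => rw [Function.iterate_succ_apply', nextExp_sink σ τ h, ih]

theorem val_sink {x : V} (h : G.kind x = .sink) : val σ τ x = G.sinkVal x := by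
  refine tendsto_nhds_unique (tendsto_val σ τ x) ?_
  simp_rw [iterate_nextExp_sink σ τ h]
  simp only [sinkPayoff, if_pos h]
  exact tendsto_const_nhds

theorem val_eq_nextExp (x : V) : val σ τ x = nextExp σ τ (val σ τ) x := by
  refine tendsto_nhds_unique ((Filter.tendsto_add_atTop_iff_nat 1).2 (tendsto_val σ τ x)) ?_
  simp_rw [Function.iterate_succ_apply']
  exact tendsto_finsetSum _ fun y _ => (tendsto_val σ τ y).const_mul _

theorem val_max {x : V} (h : G.kind x = .max) : val σ τ x = val σ τ (σ ⟨x, h⟩) := by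
  rw [val_eq_nextExp, nextExp_max σ τ h]

theorem val_min {x : V} (h : G.kind x = .min) : val σ τ x = val σ τ (τ ⟨x, h⟩) := by
  rw [val_eq_nextExp, nextExp_min σ τ h]

theorem val_ran {x : V} (h : G.kind x = .ran) : val σ τ x = ∑ y, (G.prob x y : ℝ) * val σ τ y := by
  rw [val_eq_nextExp, nextExp_ran σ τ h]

/-- The value is the least nonnegative superharmonic function that dominates the sink values. -/
theorem val_le_of_super {w : V → ℝ} (h0 : ∀ x, 0 ≤ w x)
    (hs : ∀ x, G.kind x = .sink → (G.sinkVal x : ℝ) ≤ w x)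
    (hw : ∀ x, G.kind x ≠ .sink → nextExp σ τ w x ≤ w x) (x : V) : val σ τ x ≤ w x := by
  refine le_of_tendsto' (tendsto_val σ τ x) fun n => ?_
  induction n generalizing x with
  | zero =>
    by_cases h : G.kind x = .sink
    · simpa [sinkPayoff, h] using hs x h
    · simpa [sinkPayoff, h] using h0 x
  | succ n ih =>
    rw [Function.iterate_succ_apply']
    refine (nextExp_mono σ τ ih x).trans ?_
    by_cases h : G.kind x = .sink
    · rw [nextExp_sink σ τ h]
    · exact hw x h

/-- All sink values are nonnegative. -/
def SinksNonneg (G : SSG V) : Prop := ∀ x, G.kind x = .sink → 0 ≤ G.sinkVal x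

variable (hG : G.SinksNonneg)
include hG

theorem val_nonneg (x : V) : 0 ≤ val σ τ x := by
  refine ge_of_tendsto' (tendsto_val σ τ x) fun n => ?_
  induction n generalizing x with
  | zero =>
    change 0 ≤ sinkPayoff G x
    rw [sinkPayoff]
    split_ifs with h
    · exact_mod_cast hG x h
    · exact le_rfl
  | succ n ih =>
    rw [Function.iterate_succ_apply']
    exact Finset.sum_nonneg fun y _ => mul_nonneg ENNReal.toReal_nonneg (ih y)

omit hG in
/-- `A` is closed under the moves made with positive probability, and contains no sink. -/
def IsTrap (σ : G.MaxStrategy) (τ : G.MinStrategy) (A : Set V) : Prop :=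
  ∀ x ∈ A, G.kind x ≠ .sink ∧ ∀ y, next σ τ x y ≠ 0 → y ∈ A

omit hG in
theorem nextExp_congr {w w' : V → ℝ} {x : V} (h : ∀ y, next σ τ x y ≠ 0 → w y = w' y) :
    nextExp σ τ w x = nextExp σ τ w' x := by
  refine Finset.sum_congr rfl fun y _ => ?_
  by_cases hy : next σ τ x y = 0
  · simp [hy]
  · rw [h y hy]

variable {σ τ}

theorem IsTrap.val_eq_zero {A : Set V} (hA : IsTrap σ τ A) {x : V} (hx : x ∈ A) :
    val σ τ x = 0 := by
  classical
  refine le_antisymm ?_ (val_nonneg σ τ hG x)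
  have h := val_le_of_super σ τ (w := fun x => if x ∈ A then 0 else val σ τ x)
    (fun x => by split_ifs; exacts [le_rfl, val_nonneg σ τ hG x])
    (fun x hs => by
      rw [if_neg fun h => (hA x h).1 hs, val_sink σ τ hs])
    (fun x _ => by
      by_cases hx : x ∈ A
      · rw [if_pos hx, nextExp_congr σ τ (w' := fun _ => 0) fun y hy => if_pos ((hA x hx).2 y hy)]
        simp [nextExp]
      · rw [if_neg hx, val_eq_nextExp]
        exact nextExp_mono σ τ (fun y => by split_ifs; exacts [val_nonneg σ τ hG y, le_rfl]) x) x
  simpa [hx] using h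

/-- A subharmonic function is a lower bound of the value unless it is a positive constant on some
trap: where it exceeds the value most, the play cannot leave and reaches no sink. -/
theorem le_val_of_sub {v : V → ℝ} (hs : ∀ x, G.kind x = .sink → v x ≤ G.sinkVal x)
    (hv : ∀ x, G.kind x ≠ .sink → v x ≤ nextExp σ τ v x)
    (hA : ∀ (A : Set V) (M : ℝ), 0 < M → A.Nonempty → IsTrap σ τ A → (∀ x ∈ A, v x = M) → False)
    (x : V) : v x ≤ val σ τ x := by
  by_contra! hx
  have hne : Nonempty V := ⟨x⟩
  obtain ⟨z, hz⟩ := Finite.exists_max fun y => v y - val σ τ y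
  have hz0 : 0 < v z - val σ τ z := by linarith [hz x]
  set M := v z - val σ τ z with hM
  let A : Set V := {y | v y - val σ τ y = M}
  have htrap : IsTrap σ τ A := by
    intro y hy
    have hy' : v y - val σ τ y = M := hy
    have hns : G.kind y ≠ .sink := fun h => by
      have := hs y h
      rw [val_sink σ τ h] at hy'
      linarith
    refine ⟨hns, fun a ha => ?_⟩
    have h1 := hv y hns
    have h2 := val_eq_nextExp σ τ y
    have h3 : ∑ b, (next σ τ y b).toReal * (M - (v b - val σ τ b)) ≤ 0 := by
      have : ∑ b, (next σ τ y b).toReal * (M - (v b - val σ τ b)) =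
          M * ∑ b, (next σ τ y b).toReal - nextExp σ τ v y + nextExp σ τ (val σ τ) y := by
        rw [nextExp, nextExp, Finset.mul_sum, ← Finset.sum_sub_distrib, ← Finset.sum_add_distrib]
        exact Finset.sum_congr rfl fun b _ => by ring
      rw [this, sum_next]
      linarith
    have h4 : ∀ b ∈ Finset.univ, 0 ≤ (next σ τ y b).toReal * (M - (v b - val σ τ b)) :=
      fun b _ => mul_nonneg ENNReal.toReal_nonneg (by linarith [hz b])
    have h5 := (Finset.sum_eq_zero_iff_of_nonneg h4).1 (le_antisymm h3 (Finset.sum_nonneg h4)) a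
      (Finset.mem_univ a)
    rcases mul_eq_zero.1 h5 with h | h
    · exact absurd ((ENNReal.toReal_eq_zero_iff _).1 h) (by simp [ha, PMF.apply_ne_top])
    · change v a - val σ τ a = M
      linarith
  refine hA A M hz0 ⟨z, rfl⟩ htrap fun y hy => ?_
  have h1 : v y - val σ τ y = M := hy
  rw [htrap.val_eq_zero hG hy] at h1
  linarith

end Plays

/-! ### Determinacy with nonnegative sink values -/

section Determinacy

variable {V : Type*} [Fintype V] {G : SSG V}

instance : Nonempty G.MaxStrategy := ⟨fun x => ⟨_, (G.exists_arc x).choose_spec⟩⟩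

instance : Nonempty G.MinStrategy := ⟨fun x => ⟨_, (G.exists_arc x).choose_spec⟩⟩

theorem valMax_le_val (σ : G.MaxStrategy) (τ : G.MinStrategy) (x : V) : valMax σ x ≤ val σ τ x :=
  ciInf_le (Set.finite_range _).bddBelow τ

theorem val_le_valMin (σ : G.MaxStrategy) (τ : G.MinStrategy) (x : V) : val σ τ x ≤ valMin τ x :=
  le_ciSup (f := fun σ => val σ τ x) (Set.finite_range _).bddAbove σ

theorem valMax_le_value (σ : G.MaxStrategy) (x : V) : valMax σ x ≤ G.value x :=
  le_ciSup (f := fun σ => valMax σ x) (Set.finite_range _).bddAbove σ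

theorem upperValue_le_valMin (τ : G.MinStrategy) (x : V) : G.upperValue x ≤ valMin τ x :=
  ciInf_le (Set.finite_range _).bddBelow τ

theorem value_le_upperValue (x : V) : G.value x ≤ G.upperValue x :=
  ciSup_le fun σ => le_ciInf fun τ => (valMax_le_val σ τ x).trans (val_le_valMin σ τ x)

/-- A saddle point consists of optimal strategies, and its value is the optimal value. -/
theorem areOptimal_of_saddle {σ : G.MaxStrategy} {τ : G.MinStrategy} {v : V → ℝ}
    (h1 : ∀ τ' x, v x ≤ val σ τ' x) (h2 : ∀ σ' x, val σ' τ x ≤ v x) :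
    AreOptimal σ τ ∧ G.value = v := by
  have h3 : ∀ x, v x ≤ valMax σ x := fun x => le_ciInf fun τ' => h1 τ' x
  have h4 : ∀ x, valMin τ x ≤ v x := fun x => ciSup_le fun σ' => h2 σ' x
  have h5 : ∀ x, G.value x = v x := fun x => le_antisymm
    ((value_le_upperValue x).trans ((upperValue_le_valMin τ x).trans (h4 x)))
    ((h3 x).trans (valMax_le_value σ x))
  have h6 : ∀ x, G.upperValue x = v x := fun x => le_antisymm
    ((upperValue_le_valMin τ x).trans (h4 x)) ((h5 x).ge.trans (value_le_upperValue x))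
  have h7 : ∀ x, val σ τ x = v x := fun x => le_antisymm (h2 σ x) (h1 τ x)
  refine ⟨⟨fun x => ⟨(h7 x).trans (h5 x).symm, (h7 x).trans (h6 x).symm⟩, fun x => ?_, fun x => ?_⟩,
    funext h5⟩
  · exact le_antisymm (valMax_le_value σ x) ((h5 x).le.trans (h3 x))
  · exact le_antisymm ((h4 x).trans (h6 x).ge) (upperValue_le_valMin τ x)

theorem next_congr {σ σ' : G.MaxStrategy} {τ τ' : G.MinStrategy} {x : V}
    (h1 : ∀ h, σ ⟨x, h⟩ = σ' ⟨x, h⟩) (h2 : ∀ h, τ ⟨x, h⟩ = τ' ⟨x, h⟩) :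
    next σ τ x = next σ' τ' x := by
  cases h : G.kind x
  · rw [next_max _ _ h, next_max _ _ h, h1]
  · rw [next_min _ _ h, next_min _ _ h, h2]
  · ext y
    rw [next_ran_apply _ _ h, next_ran_apply _ _ h]
  · rw [next_sink _ _ h, next_sink _ _ h]

/-- A form of `val_le_of_super` with one condition for each sort of nodes. -/
theorem val_le_of_super' (σ : G.MaxStrategy) (τ : G.MinStrategy) {w : V → ℝ} (h0 : ∀ x, 0 ≤ w x)
    (hs : ∀ x, G.kind x = .sink → (G.sinkVal x : ℝ) ≤ w x)
    (hmax : ∀ x h, w (σ ⟨x, h⟩) ≤ w x) (hmin : ∀ x h, w (τ ⟨x, h⟩) ≤ w x)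
    (hran : ∀ x, G.kind x = .ran → ∑ y, (G.prob x y : ℝ) * w y ≤ w x) (x : V) :
    val σ τ x ≤ w x := by
  refine val_le_of_super σ τ h0 hs (fun x hx => ?_) x
  cases h : G.kind x
  · rw [nextExp_max σ τ h]; exact hmax x h
  · rw [nextExp_min σ τ h]; exact hmin x h
  · rw [nextExp_ran σ τ h]; exact hran x h
  · exact absurd h hx

theorem le_val_of_sub' (hG : G.SinksNonneg) {σ : G.MaxStrategy} {τ : G.MinStrategy} {v : V → ℝ}
    (hs : ∀ x, G.kind x = .sink → v x ≤ G.sinkVal x)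
    (hmax : ∀ x h, v x ≤ v (σ ⟨x, h⟩)) (hmin : ∀ x h, v x ≤ v (τ ⟨x, h⟩))
    (hran : ∀ x, G.kind x = .ran → v x ≤ ∑ y, (G.prob x y : ℝ) * v y)
    (hA : ∀ (A : Set V) (M : ℝ), 0 < M → A.Nonempty → IsTrap σ τ A → (∀ x ∈ A, v x = M) → False)
    (x : V) : v x ≤ val σ τ x := by
  refine le_val_of_sub hG hs (fun x hx => ?_) hA x
  cases h : G.kind x
  · rw [nextExp_max σ τ h]; exact hmax x h
  · rw [nextExp_min σ τ h]; exact hmin x h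
  · rw [nextExp_ran σ τ h]; exact hran x h
  · exact absurd h hx

theorem IsTrap.max_mem {σ : G.MaxStrategy} {τ : G.MinStrategy} {A : Set V} (hA : IsTrap σ τ A)
    {x : V} (hx : x ∈ A) (h : G.kind x = .max) : (σ ⟨x, h⟩ : V) ∈ A :=
  (hA x hx).2 _ (by rw [next_max σ τ h]; simp)

theorem IsTrap.min_mem {σ : G.MaxStrategy} {τ : G.MinStrategy} {A : Set V} (hA : IsTrap σ τ A)
    {x : V} (hx : x ∈ A) (h : G.kind x = .min) : (τ ⟨x, h⟩ : V) ∈ A :=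
  (hA x hx).2 _ (by rw [next_min σ τ h]; simp)

theorem IsTrap.ran_mem {σ : G.MaxStrategy} {τ : G.MinStrategy} {A : Set V} (hA : IsTrap σ τ A)
    {x y : V} (hx : x ∈ A) (h : G.kind x = .ran) (hy : G.prob x y ≠ 0) : y ∈ A := by
  refine (hA x hx).2 _ ?_
  rw [next_ran_apply σ τ h]
  have : 0 < G.prob x y := lt_of_le_of_ne (G.prob_nonneg x y h) hy.symm
  simpa using this

theorem isTrap_of {σ : G.MaxStrategy} {τ : G.MinStrategy} {A : Set V}
    (hs : ∀ x ∈ A, G.kind x ≠ .sink) (hmax : ∀ x ∈ A, ∀ h, (σ ⟨x, h⟩ : V) ∈ A)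
    (hmin : ∀ x ∈ A, ∀ h, (τ ⟨x, h⟩ : V) ∈ A)
    (hran : ∀ x ∈ A, G.kind x = .ran → ∀ y, G.prob x y ≠ 0 → y ∈ A) : IsTrap σ τ A := by
  classical
  refine fun x hx => ⟨hs x hx, fun y hy => ?_⟩
  cases h : G.kind x
  · rw [next_max σ τ h] at hy
    have : y = (σ ⟨x, h⟩ : V) := by simpa [PMF.pure_apply] using hy
    exact this ▸ hmax x hx h
  · rw [next_min σ τ h] at hy
    have : y = (τ ⟨x, h⟩ : V) := by simpa [PMF.pure_apply] using hy
    exact this ▸ hmin x hx h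
  · refine hran x hx h y fun h0 => hy ?_
    rw [next_ran_apply σ τ h, h0]
    simp
  · exact absurd h (hs x hx)

/-- Against a fixed strategy of max, min has one strategy which is best from every node: the
pointwise minimum of two values is superharmonic for a combination of the two strategies. -/
theorem exists_best_response (hG : G.SinksNonneg) (σ : G.MaxStrategy) :
    ∃ τ, ∀ τ' x, val σ τ x ≤ val σ τ' x := by
  classical
  obtain ⟨τ, hτ⟩ := Finite.exists_min fun τ => ∑ x, val σ τ x
  refine ⟨τ, fun τ' x => ?_⟩
  by_contra! hx
  let τm : G.MinStrategy := fun z => if val σ τ' z < val σ τ z then τ' z else τ z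
  have h : ∀ z, val σ τm z ≤ min (val σ τ z) (val σ τ' z) := by
    refine val_le_of_super' σ τm (fun z => le_min (val_nonneg σ τ hG z) (val_nonneg σ τ' hG z))
      (fun z hz => by rw [val_sink σ τ hz, val_sink σ τ' hz, min_self]) (fun z hz => ?_)
      (fun z hz => ?_) (fun z hz => ?_)
    · rw [← val_max σ τ hz, ← val_max σ τ' hz]
    · by_cases hlt : val σ τ' z < val σ τ z
      · rw [min_eq_right hlt.le, val_min σ τ' hz]
        simp only [τm, if_pos hlt]
        exact min_le_right _ _
      · rw [min_eq_left (not_lt.1 hlt), val_min σ τ hz]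
        simp only [τm, if_neg hlt]
        exact min_le_left _ _
    · have hp : ∀ y, (0 : ℝ) ≤ G.prob z y := fun y => by exact_mod_cast G.prob_nonneg z y hz
      refine le_min ?_ ?_
      · rw [val_ran σ τ hz]
        exact Finset.sum_le_sum fun y _ => mul_le_mul_of_nonneg_left (min_le_left _ _) (hp y)
      · rw [val_ran σ τ' hz]
        exact Finset.sum_le_sum fun y _ => mul_le_mul_of_nonneg_left (min_le_right _ _) (hp y)
  refine absurd (hτ τm) (not_le.2 (Finset.sum_lt_sum (fun z _ => (h z).trans (min_le_left _ _))
    ⟨x, Finset.mem_univ x, (h x).trans_lt ?_⟩))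
  rwa [min_eq_right hx.le]

/-- Existence of a saddle point whose value satisfies the optimality conditions. The strategy of
max maximises the sum of the values that it ensures; an arc to a node of greater value would
improve it. -/
theorem exists_saddle (hG : G.SinksNonneg) :
    ∃ (σ : G.MaxStrategy) (τ : G.MinStrategy), (∀ τ' x, val σ τ x ≤ val σ τ' x) ∧
      (∀ σ' x, val σ' τ x ≤ val σ τ x) ∧
      (∀ x y, G.kind x = .max → G.arc x y → val σ τ y ≤ val σ τ x) ∧
      (∀ x y, G.kind x = .min → G.arc x y → val σ τ x ≤ val σ τ y) := by
  classical
  choose br hbr using exists_best_response hG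
  obtain ⟨σ, hσ⟩ := Finite.exists_max fun σ => ∑ x, val σ (br σ) x
  have hmin : ∀ x y, G.kind x = .min → G.arc x y → val σ (br σ) x ≤ val σ (br σ) y := by
    intro x y hx hxy
    by_contra! hlt
    let τ : G.MinStrategy := Function.update (br σ) ⟨x, hx⟩ ⟨y, hxy⟩
    have h : ∀ z, val σ τ z ≤ val σ (br σ) z := by
      refine val_le_of_super' σ τ (val_nonneg σ _ hG) (fun z hz => (val_sink σ _ hz).ge)
        (fun z hz => (val_max σ _ hz).ge) (fun z hz => ?_) (fun z hz => (val_ran σ _ hz).ge)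
      by_cases hzx : z = x
      · subst hzx
        simpa [τ] using hlt.le
      · have : τ ⟨z, hz⟩ = br σ ⟨z, hz⟩ := Function.update_of_ne (by simpa using hzx) _ _
        rw [this, ← val_min σ _ hz]
    have h1 : val σ τ x = val σ τ y := by
      rw [val_min σ τ hx]
      simp [τ]
    linarith [hbr σ τ x, h y]
  have hmax : ∀ x y, G.kind x = .max → G.arc x y → val σ (br σ) y ≤ val σ (br σ) x := by
    intro x y hx hxy
    by_contra! hlt
    let σ' : G.MaxStrategy := Function.update σ ⟨x, hx⟩ ⟨y, hxy⟩
    have hσx : (σ' ⟨x, hx⟩ : V) = y := by simp [σ']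
    have hσz : ∀ z (h : G.kind z = .max), z ≠ x → σ' ⟨z, h⟩ = σ ⟨z, h⟩ := fun z h hzx =>
      Function.update_of_ne (by simpa using hzx) _ _
    have h : ∀ τ z, val σ (br σ) z ≤ val σ' τ z := by
      intro τ
      refine le_val_of_sub' hG (fun z hz => (val_sink σ _ hz).le) (fun z hz => ?_)
        (fun z hz => hmin z _ hz (τ ⟨z, hz⟩).2) (fun z hz => (val_ran σ _ hz).le) ?_
      · by_cases hzx : z = x
        · subst hzx
          rw [hσx]
          exact hlt.le
        · rw [hσz z hz hzx, ← val_max σ _ hz]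
      · rintro A M hM ⟨z, hz⟩ hA hv
        have hxA : x ∉ A := fun hxA => by
          have hyA := hA.max_mem hxA hx
          rw [hσx] at hyA
          linarith [hv x hxA, hv y hyA]
        have hA' : IsTrap σ τ A := fun a ha => by
          have hne : a ≠ x := fun h => hxA (h ▸ ha)
          have : next σ τ a = next σ' τ a :=
            next_congr (fun h => (hσz a h hne).symm) (fun _ => rfl)
          rw [this]
          exact hA a ha
        linarith [hv z hz, hbr σ τ z, hA'.val_eq_zero hG hz]
    have h1 : val σ' (br σ') x = val σ' (br σ') y := by rw [val_max σ' _ hx, hσx]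
    refine absurd (hσ σ') (not_le.2 (Finset.sum_lt_sum (fun z _ => h _ z)
      ⟨x, Finset.mem_univ x, ?_⟩))
    linarith [h (br σ') y]
  refine ⟨σ, br σ, hbr σ, fun σ' => ?_, hmax, hmin⟩
  exact val_le_of_super' σ' (br σ) (val_nonneg σ _ hG) (fun z hz => (val_sink σ _ hz).ge)
    (fun z hz => hmax z _ hz (σ' ⟨z, hz⟩).2) (fun z hz => (val_min σ _ hz).ge)
    (fun z hz => (val_ran σ _ hz).ge)

theorem exists_areOptimal (hG : G.SinksNonneg) :
    ∃ (σ : G.MaxStrategy) (τ : G.MinStrategy), AreOptimal σ τ := by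
  obtain ⟨σ, τ, h1, h2, -⟩ := exists_saddle hG
  exact ⟨σ, τ, (areOptimal_of_saddle h1 h2).1⟩

/-- The optimality conditions satisfied by the optimal values. -/
structure IsOptimalityFixpoint (G : SSG V) (v : V → ℝ) : Prop where
  nonneg : ∀ x, 0 ≤ v x
  sink : ∀ x, G.kind x = .sink → v x = G.sinkVal x
  ran : ∀ x, G.kind x = .ran → v x = ∑ y, (G.prob x y : ℝ) * v y
  max_le : ∀ x y, G.kind x = .max → G.arc x y → v y ≤ v x
  max_ex : ∀ x, G.kind x = .max → ∃ y, G.arc x y ∧ v y = v x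
  min_le : ∀ x y, G.kind x = .min → G.arc x y → v x ≤ v y
  min_ex : ∀ x, G.kind x = .min → ∃ y, G.arc x y ∧ v y = v x

theorem isOptimalityFixpoint_value (hG : G.SinksNonneg) : IsOptimalityFixpoint G G.value := by
  obtain ⟨σ, τ, h1, h2, h3, h4⟩ := exists_saddle hG
  rw [(areOptimal_of_saddle h1 h2).2]
  exact ⟨val_nonneg σ τ hG, fun x h => val_sink σ τ h, fun x h => val_ran σ τ h, h3,
    fun x h => ⟨_, (σ ⟨x, h⟩).2, (val_max σ τ h).symm⟩, h4,
    fun x h => ⟨_, (τ ⟨x, h⟩).2, (val_min σ τ h).symm⟩⟩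

theorem upperValue_eq_value (hG : G.SinksNonneg) : G.upperValue = G.value := by
  obtain ⟨σ, τ, h⟩ := exists_areOptimal hG
  exact funext fun x => (h.1 x).2.symm.trans (h.1 x).1

/-- Nonnegative supersolutions of the optimality conditions. -/
structure IsSuper (G : SSG V) (w : V → ℝ) : Prop where
  nonneg : ∀ x, 0 ≤ w x
  sink : ∀ x, G.kind x = .sink → (G.sinkVal x : ℝ) ≤ w x
  ran : ∀ x, G.kind x = .ran → ∑ y, (G.prob x y : ℝ) * w y ≤ w x
  max : ∀ x y, G.kind x = .max → G.arc x y → w y ≤ w x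
  min : ∀ x, G.kind x = .min → ∃ y, G.arc x y ∧ w y ≤ w x

/-- The optimal value is the least nonnegative supersolution of the optimality conditions. -/
theorem IsSuper.value_le {w : V → ℝ} (hw : IsSuper G w) (x : V) : G.value x ≤ w x := by
  choose f hf using hw.min
  let τ : G.MinStrategy := fun z => ⟨f z.1 z.2, (hf z.1 z.2).1⟩
  refine (value_le_upperValue x).trans ((upperValue_le_valMin τ x).trans (ciSup_le fun σ => ?_))
  exact val_le_of_super' σ τ hw.nonneg hw.sink (fun z hz => hw.max z _ hz (σ ⟨z, hz⟩).2)
    (fun z hz => (hf z hz).2) hw.ran x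

theorem IsMaxOptimal.value_le_val {σ : G.MaxStrategy} (h : IsMaxOptimal σ) (τ : G.MinStrategy)
    (x : V) : G.value x ≤ val σ τ x :=
  (h x).ge.trans (valMax_le_val σ τ x)

theorem IsMinOptimal.val_le_value (hG : G.SinksNonneg) {τ : G.MinStrategy} (h : IsMinOptimal τ)
    (σ : G.MaxStrategy) (x : V) : val σ τ x ≤ G.value x :=
  (val_le_valMin σ τ x).trans ((h x).trans (congrFun (upperValue_eq_value hG) x)).le

/-- An optimal strategy of max follows arcs along which the optimal value is constant. -/
theorem IsMaxOptimal.value_eq (hG : G.SinksNonneg) {σ : G.MaxStrategy} (h : IsMaxOptimal σ)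
    {x : V} (hx : G.kind x = .max) : G.value (σ ⟨x, hx⟩) = G.value x := by
  refine le_antisymm ((isOptimalityFixpoint_value hG).max_le x _ hx (σ ⟨x, hx⟩).2) ?_
  obtain ⟨_, τ, ho⟩ := exists_areOptimal hG
  calc G.value x ≤ val σ τ x := h.value_le_val τ x
    _ = val σ τ (σ ⟨x, hx⟩) := val_max σ τ hx
    _ ≤ _ := ho.2.2.val_le_value hG σ _

/-- An optimal strategy of min follows arcs along which the optimal value is constant. -/
theorem IsMinOptimal.value_eq (hG : G.SinksNonneg) {τ : G.MinStrategy} (h : IsMinOptimal τ)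
    {x : V} (hx : G.kind x = .min) : G.value (τ ⟨x, hx⟩) = G.value x := by
  refine le_antisymm ?_ ((isOptimalityFixpoint_value hG).min_le x _ hx (τ ⟨x, hx⟩).2)
  obtain ⟨σ, _, ho⟩ := exists_areOptimal hG
  calc G.value (τ ⟨x, hx⟩) ≤ val σ τ (τ ⟨x, hx⟩) := ho.2.1.value_le_val τ _
    _ = val σ τ x := (val_min σ τ hx).symm
    _ ≤ _ := h.val_le_value hG σ x

end Determinacy

/-! ### Values of the modified games -/

section Modified

variable {V : Type*} [Fintype V] {G : SSG V} (hG : G.SinksNonneg)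

/-- The vector of optimal values of `G[p]`, over all its nodes. -/
def modVal (G : SSG V) (p : G.Ran → G.Ran → Prop) : V ⊕ G.Ran → ℝ := (G.modified p).value

/-- The control node `i` is constrained in `G[p]`. -/
def Constr (G : SSG V) (p : G.Ran → G.Ran → Prop) (i : G.Ran) : Prop :=
  G.modVal p (.inr i) < G.modVal p (.inl i.1)

variable {p q : G.Ran → G.Ran → Prop}

include hG

theorem sinksNonneg_modified (p : G.Ran → G.Ran → Prop) : (G.modified p).SinksNonneg := by
  rintro (x | i) h
  · exact hG x h
  · cases h

theorem isOptimalityFixpoint_modVal (p : G.Ran → G.Ran → Prop) :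
    IsOptimalityFixpoint (G.modified p) (G.modVal p) :=
  isOptimalityFixpoint_value (sinksNonneg_modified hG p)

theorem modVal_le_ran (p : G.Ran → G.Ran → Prop) (i : G.Ran) :
    G.modVal p (.inr i) ≤ G.modVal p (.inl i.1) :=
  (isOptimalityFixpoint_modVal hG p).min_le (.inr i) _ rfl (Or.inl rfl)

theorem modVal_le_of_rel {i j : G.Ran} (hij : j ≠ i) (h : p i j) :
    G.modVal p (.inr i) ≤ G.modVal p (.inr j) :=
  (isOptimalityFixpoint_modVal hG p).min_le (.inr i) _ rfl (Or.inr ⟨j, hij, h, rfl⟩)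

/-- A constrained control node has an arc to a control node of the same value. -/
theorem Constr.exists_rel {i : G.Ran} (hi : G.Constr p i) :
    ∃ j, j ≠ i ∧ p i j ∧ G.modVal p (.inr j) = G.modVal p (.inr i) := by
  obtain ⟨w, hw | ⟨j, hj, hp, hw⟩, h⟩ := (isOptimalityFixpoint_modVal hG p).min_ex (.inr i) rfl
  · subst hw
    exact absurd h (ne_of_gt hi)
  · subst hw
    exact ⟨j, hj, hp, h⟩

/-- The optimal values of `G[q]` are at most those of `G[p]` if, in `G[q]`, every control node
still has an arc to a node of value (in `G[p]`) not greater than its own. -/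
theorem modVal_le_modVal (h : ∀ i, ¬ G.Constr p i ∨
    ∃ j, j ≠ i ∧ q i j ∧ G.modVal p (.inr j) = G.modVal p (.inr i)) :
    G.modVal q ≤ G.modVal p := by
  have F := isOptimalityFixpoint_modVal hG p
  have : IsSuper (G.modified q) (G.modVal p) := by
    refine ⟨F.nonneg, ?_, ?_, ?_, ?_⟩
    · rintro (x | i) hx
      · exact (F.sink (.inl x) hx).ge
      · cases hx
    · rintro (x | i) hx
      · exact (F.ran (.inl x) hx).ge
      · cases hx
    · rintro (x | i) y hx hxy
      · exact F.max_le (.inl x) y hx hxy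
      · cases hx
    · rintro (x | i) hx
      · obtain ⟨y, hy, he⟩ := F.min_ex (.inl x) hx
        exact ⟨y, hy, he.le⟩
      · rcases h i with hi | ⟨j, hj, hq, he⟩
        · exact ⟨_, Or.inl rfl, not_lt.1 hi⟩
        · exact ⟨_, Or.inr ⟨j, hj, hq, rfl⟩, he.le⟩
  exact this.value_le

theorem modVal_antitone (h : ∀ i j, i ≠ j → q i j → p i j) : G.modVal p ≤ G.modVal q := by
  refine modVal_le_modVal hG fun i => ?_
  by_cases hi : G.Constr q i
  · obtain ⟨j, hj, hq, he⟩ := hi.exists_rel hG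
    exact Or.inr ⟨j, hj, h i j hj.symm hq, he⟩
  · exact Or.inl hi

/-- Arcs between control nodes can be removed without a change of value as long as every
constrained node keeps an arc to a node of the same value. -/
theorem modVal_eq_of_sub (h : ∀ i j, i ≠ j → q i j → p i j) (h' : ∀ i, G.Constr p i →
    ∃ j, j ≠ i ∧ q i j ∧ G.modVal p (.inr j) = G.modVal p (.inr i)) :
    G.modVal q = G.modVal p := by
  refine le_antisymm (modVal_le_modVal hG fun i => ?_) (modVal_antitone hG h)
  by_cases hi : G.Constr p i
  · exact Or.inr (h' i hi)
  · exact Or.inl hi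

theorem modVal_congr (h : ∀ i j, i ≠ j → (p i j ↔ q i j)) : G.modVal p = G.modVal q :=
  le_antisymm (modVal_antitone hG fun i j hij => (h i j hij).2)
    (modVal_antitone hG fun i j hij => (h i j hij).1)

omit hG in
/-- Reversal of the arcs of `p` from `i` to the control nodes of the same value. This is the effect
of pivoting on `i`. -/
def flip (G : SSG V) (p : G.Ran → G.Ran → Prop) (i : G.Ran) (a b : G.Ran) : Prop :=
  (p a b ∧ ¬ (a = i ∧ G.modVal p (.inr b) = G.modVal p (.inr i))) ∨
    (b = i ∧ p i a ∧ G.modVal p (.inr a) = G.modVal p (.inr i))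

/-- Pivoting on a constrained node increases the values. The strategy of max that is optimal in
`G[p]` still ensures `Val[p]` after the pivot: all moves of min are non-decreasing for `Val[p]`, and
strictly increasing at `i`, so that a trap on which `Val[p]` is constant avoids `i`, hence the new
arcs. -/
theorem modVal_lt_flip {i : G.Ran} (hi : G.Constr p i) :
    G.modVal p < G.modVal (G.flip p i) := by
  classical
  have hH := sinksNonneg_modified hG p
  have hH' := sinksNonneg_modified hG (G.flip p i)
  have F := isOptimalityFixpoint_modVal hG p
  have hnew : ∀ w, (G.modified (G.flip p i)).arc (.inr i) w →
      G.modVal p (.inr i) < G.modVal p w := by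
    rintro w (rfl | ⟨j, hj, h | h, rfl⟩)
    · exact hi
    · exact lt_of_le_of_ne (modVal_le_of_rel hG hj h.1) fun he => h.2 ⟨rfl, he.symm⟩
    · exact absurd h.1 hj
  refine lt_of_le_of_ne (fun x => ?_) fun he => ?_
  swap
  · obtain ⟨w, hw, h⟩ := (isOptimalityFixpoint_modVal hG (G.flip p i)).min_ex (.inr i) rfl
    rw [← he] at h
    exact absurd h (hnew w hw).ne'
  obtain ⟨σ, _, ho⟩ := exists_areOptimal hH
  have hσ : IsMaxOptimal σ := ho.2.1
  have harc : ∀ z w, (G.modified p).kind z = .max → (G.modified p).arc z w →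
      (G.modified (G.flip p i)).arc z w := by
    rintro (z | a) w hz h
    · exact h
    · cases hz
  let σ' : (G.modified (G.flip p i)).MaxStrategy := fun z =>
    ⟨(σ ⟨z.1, z.2⟩).1, harc _ _ z.2 (σ ⟨z.1, z.2⟩).2⟩
  have hσ' : ∀ z h, (σ' ⟨z, h⟩ : V ⊕ G.Ran) = (σ ⟨z, h⟩ : V ⊕ G.Ran) := fun _ _ => rfl
  have key : ∀ τ' x, G.modVal p x ≤ val σ' τ' x := by
    intro τ'
    have k1 : ∀ z, (G.modified (G.flip p i)).kind z = .sink →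
        G.modVal p z ≤ (G.modified (G.flip p i)).sinkVal z := by
      rintro (z | a) hz
      · exact (F.sink (.inl z) hz).le
      · cases hz
    have k2 : ∀ z h, G.modVal p z ≤ G.modVal p (σ' ⟨z, h⟩) := fun z hz => by
      rw [hσ']
      exact (hσ.value_eq hH hz).ge
    have k3 : ∀ z h, G.modVal p z ≤ G.modVal p (τ' ⟨z, h⟩) := by
      intro z hz
      have harc' := (τ' ⟨z, hz⟩).2
      generalize ((τ' ⟨z, hz⟩ : {y // _}) : V ⊕ G.Ran) = w at harc'
      rcases z with z | a
      · exact F.min_le (.inl z) w hz harc'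
      · rcases harc' with rfl | ⟨j, hj, h | h, rfl⟩
        · exact modVal_le_ran hG p a
        · exact modVal_le_of_rel hG hj h.1
        · rw [h.1, h.2.2]
    have k4 : ∀ z, (G.modified (G.flip p i)).kind z = .ran → G.modVal p z ≤
        ∑ y, ((G.modified (G.flip p i)).prob z y : ℝ) * G.modVal p y := by
      rintro (z | a) hz
      · exact (F.ran (.inl z) hz).le
      · cases hz
    refine le_val_of_sub' hH' k1 k2 k3 k4 ?_
    · rintro A M hM ⟨z, hzA⟩ hA hv
      have hiA : (.inr i : V ⊕ G.Ran) ∉ A := fun hiA => by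
        have h1 := hA.min_mem hiA (rfl : (G.modified (G.flip p i)).kind (.inr i) = .min)
        have h2 := hnew _ (τ' ⟨.inr i, rfl⟩).2
        rw [hv _ hiA, hv _ h1] at h2
        exact lt_irrefl _ h2
      let τ : (G.modified p).MinStrategy := fun z =>
        if h : (G.modified p).arc z.1 (τ' ⟨z.1, z.2⟩).1 then ⟨_, h⟩
        else ⟨_, ((G.modified p).exists_arc z.1).choose_spec⟩
      have hτ : ∀ z ∈ A, ∀ h : (G.modified p).kind z = .min, (τ ⟨z, h⟩).1 = (τ' ⟨z, h⟩).1 := by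
        intro z hzA hz
        have h1 := (τ' ⟨z, hz⟩).2
        have h2 := hA.min_mem hzA hz
        have h3 : (G.modified p).arc z (τ' ⟨z, hz⟩).1 := by
          generalize ((τ' ⟨z, hz⟩ : {y // _}) : V ⊕ G.Ran) = w at h1 h2
          rcases z with z | a
          · exact h1
          · rcases h1 with rfl | ⟨j, hj, h | h, rfl⟩
            · exact Or.inl rfl
            · exact Or.inr ⟨j, hj, h.1, rfl⟩
            · exact absurd (h.1 ▸ h2) hiA
        simp only [τ, dif_pos h3]
      have hA' : IsTrap σ τ A := by
        refine isTrap_of (fun z hz => (hA z hz).1) (fun z hz h => ?_)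
          (fun z hz h => ?_) (fun z hz h y hy => ?_)
        · rw [← hσ' z h]
          exact hA.max_mem hz h
        · rw [hτ z hz h]
          exact hA.min_mem hz h
        · rcases z with z | a
          · exact hA.ran_mem hz h hy
          · cases h
      have h1 := hσ.value_le_val τ z
      rw [hA'.val_eq_zero hH hzA] at h1
      have h2 : G.modVal p z = M := hv z hzA
      have h3 : G.modVal p z ≤ 0 := h1
      linarith
  exact le_trans (le_ciInf fun τ' => key τ' x) (valMax_le_value σ' x)

end Modified

end SSG

/-! ### The numbers that bound the expected length of a run -/

/-- The solution of `a (n + 1) = a n + (a 0 + ⋯ + a n) / (n + 1)`, `a 0 = 1`: see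
`succ_mul_facetBound`. -/
def facetBound (n : ℕ) : ℝ := ∑ k ∈ Finset.range (n + 1), (n.choose k : ℝ) / k.factorial

theorem facetBound_eq {n N : ℕ} (h : n < N) :
    facetBound n = ∑ k ∈ Finset.range N, (n.choose k : ℝ) / k.factorial := by
  refine Finset.sum_subset (Finset.range_mono h) fun k _ hk => ?_
  rw [Nat.choose_eq_zero_of_lt (by simpa using hk)]
  simp

theorem facetBound_zero : facetBound 0 = 1 := by simp [facetBound]

theorem facetBound_nonneg (n : ℕ) : 0 ≤ facetBound n :=
  Finset.sum_nonneg fun _ _ => by positivity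

theorem facetBound_mono : Monotone facetBound := by
  intro m n h
  rw [facetBound_eq (Nat.lt_succ_of_le h), facetBound]
  refine Finset.sum_le_sum fun k _ => ?_
  gcongr

theorem sum_range_facetBound {n N : ℕ} (h : n ≤ N) :
    ∑ i ∈ Finset.range n, facetBound i =
      ∑ j ∈ Finset.range N, (n.choose (j + 1) : ℝ) / j.factorial := by
  induction n with
  | zero => simp
  | succ n ih =>
    rw [Finset.sum_range_succ, ih (by omega), facetBound_eq (show n < N by omega),
      ← Finset.sum_add_distrib]
    refine Finset.sum_congr rfl fun j _ => ?_
    rw [Nat.choose_succ_succ]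
    push_cast
    ring

theorem succ_mul_facetBound (n : ℕ) :
    ((n : ℝ) + 1) * facetBound (n + 1) =
      (n + 1) * facetBound n + ∑ i ∈ Finset.range (n + 1), facetBound i := by
  have e1 : facetBound (n + 1) = ∑ j ∈ Finset.range (n + 1),
      ((n + 1).choose (j + 1) : ℝ) / (j + 1).factorial + 1 := by
    rw [facetBound, Finset.sum_range_succ']
    simp
  have e2 : facetBound n = ∑ j ∈ Finset.range (n + 1),
      (n.choose (j + 1) : ℝ) / (j + 1).factorial + 1 := by
    rw [facetBound_eq (show n < n + 1 + 1 by omega), Finset.sum_range_succ']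
    simp
  rw [sum_range_facetBound le_rfl, e1, e2, mul_add, mul_add, Finset.mul_sum, Finset.mul_sum,
    add_right_comm, ← Finset.sum_add_distrib]
  congr 1
  refine Finset.sum_congr rfl fun j _ => ?_
  have h1 : ((n : ℝ) + 1) * n.choose j = (n + 1).choose (j + 1) * (j + 1) := by
    exact_mod_cast Nat.add_one_mul_choose_eq n j
  have h2 : ((n + 1).choose (j + 1) : ℝ) = n.choose j + n.choose (j + 1) := by
    exact_mod_cast Nat.choose_succ_succ n j
  have h3 : ((j + 1).factorial : ℝ) = (j + 1) * j.factorial := by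
    exact_mod_cast Nat.factorial_succ j
  have h4 : (j.factorial : ℝ) ≠ 0 := by positivity
  have h5 : (j : ℝ) + 1 ≠ 0 := by positivity
  rw [h3]
  field_simp
  linear_combination ((n : ℝ) + 1) * h2 + h1

theorem facetBound_le_exp (n : ℕ) : facetBound n ≤ Real.exp (2 * √n) := by
  have h1 : ∀ k ∈ Finset.range (n + 1), (n.choose k : ℝ) / k.factorial ≤
      (√n ^ k / k.factorial) ^ 2 := by
    intro k _
    have h2 : (n.choose k : ℝ) ≤ n ^ k / k.factorial := Nat.choose_le_pow_div k n
    have h3 : (√n ^ k / k.factorial : ℝ) ^ 2 = n ^ k / k.factorial / k.factorial := by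
      rw [div_pow, ← pow_mul, mul_comm k 2, pow_mul, Real.sq_sqrt (Nat.cast_nonneg n)]
      ring
    rw [h3]
    gcongr
  calc facetBound n ≤ ∑ k ∈ Finset.range (n + 1), (√n ^ k / k.factorial : ℝ) ^ 2 :=
        Finset.sum_le_sum h1
    _ ≤ (∑ k ∈ Finset.range (n + 1), √n ^ k / k.factorial) ^ 2 :=
        Finset.sum_sq_le_sq_sum_of_nonneg fun k _ => by positivity
    _ ≤ Real.exp √n ^ 2 := by
        gcongr
        exact Real.sum_le_exp_of_nonneg (Real.sqrt_nonneg _) _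
    _ = Real.exp (2 * √n) := by rw [← Real.exp_nat_mul]; norm_num

open Classical in
/-- The number of elements above `b`, for a random `b` in a finite set with a strict partial order,
is at most uniformly distributed, in the sense tested by the monotone function `facetBound`. -/
theorem sum_facetBound_card_le {α : Type*} (r : α → α → Prop) (irr : ∀ a, ¬ r a a)
    (tr : ∀ a b c, r a b → r b c → r a c) (F : Finset α) :
    ∑ b ∈ F, facetBound (F.filter (r b)).card ≤ ∑ i ∈ Finset.range F.card, facetBound i := by
  induction hn : F.card generalizing F with
  | zero => simp [Finset.card_eq_zero.1 hn]
  | succ n ih =>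
    obtain ⟨a, ha, hmax⟩ := Finset.exists_max_image F (fun a => (F.filter (r a)).card)
      (Finset.card_pos.1 (by omega))
    -- An element with the most elements above it is minimal.
    have hmin : ∀ b ∈ F, ¬ r b a := fun b hb hba => by
      refine absurd (hmax b hb) (not_le.2 (Finset.card_lt_card ?_))
      rw [Finset.ssubset_iff_of_subset fun c hc => ?_]
      · exact ⟨a, by simp [ha, hba], by simp [irr]⟩
      · simp only [Finset.mem_filter] at hc ⊢
        exact ⟨hc.1, tr _ _ _ hba hc.2⟩
    have hcard : (F.erase a).card = n := by rw [Finset.card_erase_of_mem ha]; omega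
    rw [← Finset.sum_erase_add _ _ ha, Finset.sum_range_succ]
    refine add_le_add ?_ (facetBound_mono ?_)
    · refine (Finset.sum_le_sum fun b hb => facetBound_mono (Finset.card_le_card ?_)).trans
        (ih (F.erase a) hcard)
      intro c hc
      simp only [Finset.mem_filter, Finset.mem_erase] at hb hc ⊢
      exact ⟨⟨fun h => hmin b hb.2 (h ▸ hc.2), hc.1⟩, hc.2⟩
    · rw [← hcard]
      refine Finset.card_le_card fun c hc => ?_
      simp only [Finset.mem_filter, Finset.mem_erase] at hc ⊢
      exact ⟨fun h => irr a (h ▸ hc.2), hc.1⟩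

namespace SSG

/-! ### Runs restricted to the last pairs of the enumeration -/

section Phases

variable {V : Type*} [Fintype V] {G : SSG V}

/-- The part of `p` that concerns the pairs of nonzero priority. -/
def restrictTo (pri : Sym2 G.Ran → ℕ) (p : G.Ran → G.Ran → Prop) (a b : G.Ran) : Prop :=
  p a b ∧ pri s(a, b) ≠ 0

/-- `p` is an orientation of the pairs of nonzero priority. -/
def IsOrientation (pri : Sym2 G.Ran → ℕ) (p : G.Ran → G.Ran → Prop) : Prop :=
  (∀ a b, p a b → pri s(a, b) ≠ 0) ∧ ∀ a b, pri s(a, b) ≠ 0 → (p a b ↔ ¬ p b a)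

/-- `p` has an arc from `i` to the control node `j`, which has the same value in `G[p]`. -/
def FollowsIn (G : SSG V) (p : G.Ran → G.Ran → Prop) (i j : G.Ran) : Prop :=
  p i j ∧ G.modVal p (.inr j) = G.modVal p (.inr i)

/-- The pivot selection rule for the game `G[p]`, where pairs are enumerated in the order of their
priorities. -/
def Sel (G : SSG V) (pri : Sym2 G.Ran → ℕ) (p : G.Ran → G.Ran → Prop) (i : G.Ran) : Prop :=
  G.Constr p i ∧ ∀ i', G.Constr p i' →
    ∃ j', G.FollowsIn p i' j' ∧ ∀ j, G.FollowsIn p i j → pri s(i, j) ≤ pri s(i', j')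

/-- The addition of the arc `(i, j)` to `p`. -/
def addArc (p : G.Ran → G.Ran → Prop) (i j x y : G.Ran) : Prop := p x y ∨ (x = i ∧ y = j)

/-- Distinct pairs of nonzero priority have distinct priorities. -/
def IsPriority (pri : Sym2 G.Ran → ℕ) : Prop := ∀ e e', pri e ≠ 0 → pri e = pri e' → e = e'

variable {pri : Sym2 G.Ran → ℕ} {p : G.Ran → G.Ran → Prop}

theorem IsOrientation.irrefl (hp : IsOrientation pri p) (a : G.Ran) : ¬ p a a := fun h =>
  (hp.2 a a (hp.1 a a h)).1 h h

theorem IsOrientation.asymm (hp : IsOrientation pri p) {a b : G.Ran} (h : p a b) : ¬ p b a :=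
  (hp.2 a b (hp.1 a b h)).1 h

theorem Sel.unique (hpri : IsPriority pri) (hp : IsOrientation pri p) {i i' : G.Ran}
    (h : G.Sel pri p i) (h' : G.Sel pri p i') : i = i' := by
  obtain ⟨j', hj', h1⟩ := h.2 i' h'.1
  obtain ⟨j, hj, h2⟩ := h'.2 i h.1
  have e := hpri _ _ (hp.1 _ _ hj.1) (le_antisymm (h1 j hj) (h2 j' hj'))
  rcases Sym2.eq_iff.1 e with ⟨e1, _⟩ | ⟨e1, e2⟩
  · exact e1
  · refine absurd hj.1 (hp.asymm ?_)
    rw [e1, e2]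
    exact hj'.1

theorem IsOrientation.flip (hp : IsOrientation pri p) (i : G.Ran) :
    IsOrientation pri (G.flip p i) := by
  refine ⟨fun a b h => ?_, fun a b h => ?_⟩
  · rcases h with h | ⟨rfl, h, _⟩
    · exact hp.1 a b h.1
    · rw [Sym2.eq_swap]
      exact hp.1 _ _ h
  · have h1 := hp.2 a b h
    have h2 := hp.irrefl i
    by_cases ha : a = i
    · subst ha
      have hb : b ≠ a := fun hb => by
        subst hb
        exact iff_not_self h1
      simp only [SSG.flip, hb, true_and, false_and, and_true, not_false_eq_true, or_false]
      generalize (G.modVal p (.inr b) = G.modVal p (.inr a)) = E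
      revert h1
      generalize p a b = P
      generalize p b a = Q
      tauto
    · by_cases hb : b = i
      · subst hb
        simp only [SSG.flip, ha, true_and, false_and, and_true, not_false_eq_true, or_false]
        generalize (G.modVal p (.inr a) = G.modVal p (.inr b)) = E
        revert h1
        generalize p a b = P
        generalize p b a = Q
        tauto
      · simpa only [SSG.flip, ha, hb, false_and, and_true, not_false_eq_true, or_false] using h1

theorem exists_sel (hG : G.SinksNonneg) {i₀ : G.Ran} (h₀ : G.Constr p i₀) :
    ∃ i, G.Sel pri p i := by
  classical
  let S : G.Ran → Finset G.Ran := fun i => Finset.univ.filter (G.FollowsIn p i)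
  let f : G.Ran → ℕ := fun i => (S i).sup fun j => pri s(i, j)
  have hS : ∀ i j, j ∈ S i ↔ G.FollowsIn p i j := fun i j => by simp [S]
  obtain ⟨i, hi, hmin⟩ := Finset.exists_min_image (Finset.univ.filter (G.Constr p)) f
    ⟨i₀, by simpa using h₀⟩
  simp only [Finset.mem_filter, Finset.mem_univ, true_and] at hi hmin
  refine ⟨i, hi, fun i' hi' => ?_⟩
  obtain ⟨j, -, hj, he⟩ := hi'.exists_rel hG
  obtain ⟨j', hj', h⟩ := Finset.exists_mem_eq_sup (S i')
    ⟨j, (hS _ _).2 ⟨hj, he⟩⟩ fun j => pri s(i', j)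
  refine ⟨j', (hS _ _).1 hj', fun j hj => ?_⟩
  refine le_trans (Finset.le_sup (f := fun j => pri s(i, j)) ((hS _ _).2 hj)) ?_
  exact (hmin i' hi').trans h.le

open Classical in
/-- The pairs of priority zero whose two orientations are compatible with a lower bound `u` of the
values: only these can be reversed later, as long as `p` is kept. -/
def freePairs (G : SSG V) (pri : Sym2 G.Ran → ℕ) (u : WithBot (V ⊕ G.Ran → ℝ))
    (p : G.Ran → G.Ran → Prop) : Finset (Sym2 G.Ran) :=
  Finset.univ.filter fun c => ¬ c.IsDiag ∧ pri c = 0 ∧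
    ∀ a b, c = s(a, b) → u < ((G.modVal (addArc p a b) : V ⊕ G.Ran → ℝ) : WithBot _)

/-- Some orientation of the pair `b` gives smaller values than both orientations of the pair `c`. -/
def PairLT (G : SSG V) (p : G.Ran → G.Ran → Prop) (b c : Sym2 G.Ran) : Prop :=
  ∃ i j, b = s(i, j) ∧ ∀ x y, c = s(x, y) → G.modVal (addArc p i j) < G.modVal (addArc p x y)

theorem PairLT.irrefl (p : G.Ran → G.Ran → Prop) (b : Sym2 G.Ran) : ¬ G.PairLT p b b := by
  rintro ⟨i, j, hb, h⟩
  exact lt_irrefl _ (h i j hb)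

theorem PairLT.trans (p : G.Ran → G.Ran → Prop) (a b c : Sym2 G.Ran) (h : G.PairLT p a b)
    (h' : G.PairLT p b c) : G.PairLT p a c := by
  obtain ⟨i, j, ha, h⟩ := h
  obtain ⟨k, l, hb, h'⟩ := h'
  exact ⟨i, j, ha, fun x y hc => (h k l hb).trans (h' x y hc)⟩

open Classical in
/-- The sum of `facetBound` of the number of free pairs, over the first `n` steps of the run from
the orientation `p`. At each step but the first, the lower bound of the values is the value of the
previous step. -/
def runCost (G : SSG V) (pri : Sym2 G.Ran → ℕ) :
    ℕ → WithBot (V ⊕ G.Ran → ℝ) → (G.Ran → G.Ran → Prop) → ℝ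
  | 0, _, _ => 0
  | n + 1, u, p => facetBound (G.freePairs pri u p).card +
      if h : ∃ i, G.Sel pri p i then runCost G pri n (G.modVal p) (G.flip p h.choose) else 0

open Classical in
/-- An upper bound for the contribution of one step to the cost, once the pair `b` is given a
nonzero priority. If `b` is free, the step may be divided in two by a reversal of `b`. -/
def splitCost (G : SSG V) (pri : Sym2 G.Ran → ℕ) (b : Sym2 G.Ran)
    (u : WithBot (V ⊕ G.Ran → ℝ)) (p : G.Ran → G.Ran → Prop) : ℝ :=
  if b ∈ G.freePairs pri u p then facetBound ((G.freePairs pri u p).card - 1) +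
    facetBound ((G.freePairs pri u p).filter (G.PairLT p b)).card
  else facetBound (G.freePairs pri u p).card

open Classical in
/-- The sum of `splitCost` over the first `n` steps of the run from `p`. -/
def runSplitCost (G : SSG V) (pri : Sym2 G.Ran → ℕ) (b : Sym2 G.Ran) :
    ℕ → WithBot (V ⊕ G.Ran → ℝ) → (G.Ran → G.Ran → Prop) → ℝ
  | 0, _, _ => 0
  | n + 1, u, p => G.splitCost pri b u p +
      if h : ∃ i, G.Sel pri p i then runSplitCost G pri b n (G.modVal p) (G.flip p h.choose) else 0

theorem splitCost_nonneg (b : Sym2 G.Ran) (u : WithBot (V ⊕ G.Ran → ℝ)) :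
    0 ≤ G.splitCost pri b u p := by
  unfold splitCost
  split_ifs
  · exact add_nonneg (facetBound_nonneg _) (facetBound_nonneg _)
  · exact facetBound_nonneg _

theorem runSplitCost_le_succ (b : Sym2 G.Ran) (n : ℕ) (u : WithBot (V ⊕ G.Ran → ℝ)) :
    G.runSplitCost pri b n u p ≤ G.runSplitCost pri b (n + 1) u p := by
  induction n generalizing u p with
  | zero =>
    simp only [runSplitCost]
    split_ifs <;> simpa using splitCost_nonneg b u
  | succ n ih =>
    rw [runSplitCost, runSplitCost]
    split_ifs with h
    · gcongr
      exact ih _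
    · exact le_rfl

theorem runCost_succ_of_sel (hpri : IsPriority pri) (hp : IsOrientation pri p) {i : G.Ran}
    (hi : G.Sel pri p i) (n : ℕ) (u : WithBot (V ⊕ G.Ran → ℝ)) :
    G.runCost pri (n + 1) u p = facetBound (G.freePairs pri u p).card +
      G.runCost pri n (G.modVal p) (G.flip p i) := by
  have h : ∃ i, G.Sel pri p i := ⟨i, hi⟩
  rw [runCost, dif_pos h, Sel.unique hpri hp h.choose_spec hi]

theorem runSplitCost_succ_of_sel (hpri : IsPriority pri) (hp : IsOrientation pri p) {i : G.Ran}
    (hi : G.Sel pri p i) (b : Sym2 G.Ran) (n : ℕ) (u : WithBot (V ⊕ G.Ran → ℝ)) :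
    G.runSplitCost pri b (n + 1) u p = G.splitCost pri b u p +
      G.runSplitCost pri b n (G.modVal p) (G.flip p i) := by
  have h : ∃ i, G.Sel pri p i := ⟨i, hi⟩
  rw [runSplitCost, dif_pos h, Sel.unique hpri hp h.choose_spec hi]

theorem runCost_succ_of_not_sel (h : ¬ ∃ i, G.Sel pri p i) (n : ℕ)
    (u : WithBot (V ⊕ G.Ran → ℝ)) :
    G.runCost pri (n + 1) u p = facetBound (G.freePairs pri u p).card := by
  rw [runCost, dif_neg h, add_zero]

theorem splitCost_le_runSplitCost (b : Sym2 G.Ran) (n : ℕ) (u : WithBot (V ⊕ G.Ran → ℝ)) :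
    G.splitCost pri b u p ≤ G.runSplitCost pri b (n + 1) u p := by
  induction n with
  | zero => simp [runSplitCost]
  | succ n ih => exact ih.trans (runSplitCost_le_succ b _ u)

end Phases

/-- A new pair `b`, of lower priority than all pairs of nonzero priority. -/
structure IsExtension {ι : Type*} (pri pri' : Sym2 ι → ℕ) (b : Sym2 ι) : Prop where
  not_isDiag : ¬ b.IsDiag
  zero : pri b = 0
  ne_zero : pri' b ≠ 0
  eq_of_ne : ∀ e, e ≠ b → pri' e = pri e
  lt : ∀ e, pri e ≠ 0 → pri' b < pri e

section Split

variable {V : Type*} [Fintype V] {G : SSG V} {pri pri' : Sym2 G.Ran → ℕ} {b : Sym2 G.Ran}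
  {p : G.Ran → G.Ran → Prop}

theorem IsExtension.ne (hb : IsExtension pri pri' b) {e : Sym2 G.Ran} (he : pri e ≠ 0) : e ≠ b :=
  fun h => he (h ▸ hb.zero)

theorem IsExtension.isPriority (hb : IsExtension pri pri' b) (h : IsPriority pri') :
    IsPriority pri := by
  intro e e' he hee
  refine h e e' ?_ ?_
  · rw [hb.eq_of_ne e (hb.ne he)]; exact he
  · rw [hb.eq_of_ne e (hb.ne he), hb.eq_of_ne e' (hb.ne (hee ▸ he)), hee]

theorem IsExtension.isOrientation (hb : IsExtension pri pri' b) (hp : IsOrientation pri' p) :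
    IsOrientation pri (restrictTo pri p) := by
  refine ⟨fun x y h => h.2, fun x y h => ?_⟩
  have h1 := hp.2 x y (by rw [hb.eq_of_ne _ (hb.ne h)]; exact h)
  have h2 : pri s(y, x) ≠ 0 := by rwa [Sym2.eq_swap]
  unfold restrictTo
  tauto

/-- A pivot whose selection is due to a pair other than `b` is also a pivot of the run that ignores
`b`: the arc on `b` can be removed without a change of value. -/
theorem sel_restrictTo (hG : G.SinksNonneg) (hb : IsExtension pri pri' b)
    (hp : IsOrientation pri' p) {i j : G.Ran} (hi : G.Sel pri' p i) (hj : G.FollowsIn p i j)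
    (hij : pri s(i, j) ≠ 0) :
    G.modVal (restrictTo pri p) = G.modVal p ∧ G.Sel pri (restrictTo pri p) i ∧
      restrictTo pri (G.flip p i) = G.flip (restrictTo pri p) i := by
  have key : ∀ i', G.Constr p i' → ∃ j', G.FollowsIn p i' j' ∧ pri s(i', j') ≠ 0 ∧
      ∀ j, G.FollowsIn p i j → pri' s(i, j) ≤ pri' s(i', j') := by
    intro i' hi'
    obtain ⟨j', hj', h⟩ := hi.2 i' hi'
    refine ⟨j', hj', fun h0 => ?_, h⟩
    have h1 := h j hj
    have h2 := hb.lt _ hij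
    rw [hb.eq_of_ne _ (hb.ne hij)] at h1
    by_cases he : s(i', j') = b
    · rw [he] at h1
      omega
    · rw [hb.eq_of_ne _ he] at h1
      omega
  have hv : G.modVal (restrictTo pri p) = G.modVal p := by
    refine modVal_eq_of_sub hG (fun _ _ _ h => h.1) fun i' hi' => ?_
    obtain ⟨j', hj', h0, -⟩ := key i' hi'
    exact ⟨j', fun h => hp.irrefl i' (h ▸ hj'.1), ⟨hj'.1, h0⟩, hj'.2⟩
  have hc : ∀ i', G.Constr (restrictTo pri p) i' ↔ G.Constr p i' := fun i' => by
    rw [Constr, Constr, hv]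
  refine ⟨hv, ⟨(hc i).2 hi.1, fun i' hi' => ?_⟩, ?_⟩
  · obtain ⟨j', hj', h0, h⟩ := key i' ((hc i').1 hi')
    refine ⟨j', ⟨⟨hj'.1, h0⟩, by rw [hv]; exact hj'.2⟩, fun l hl => ?_⟩
    have h1 := h l ⟨hl.1.1, by rw [← hv]; exact hl.2⟩
    rwa [hb.eq_of_ne _ (hb.ne h0), hb.eq_of_ne _ (hb.ne hl.1.2)] at h1
  · funext x y
    have h1 : s(y, x) = s(x, y) := Sym2.eq_swap
    have h2 : y = i → s(i, x) = s(x, y) := fun h => h ▸ h1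
    simp only [restrictTo, SSG.flip, hv, eq_iff_iff]
    constructor
    · rintro ⟨h | ⟨hy, h, h'⟩, h0⟩
      · exact Or.inl ⟨⟨h.1, h0⟩, h.2⟩
      · exact Or.inr ⟨hy, ⟨h, by rwa [h2 hy]⟩, h'⟩
    · rintro (⟨⟨h, h0⟩, h'⟩ | ⟨hy, ⟨h, h0⟩, h'⟩)
      · exact ⟨Or.inl ⟨h, h'⟩, h0⟩
      · exact ⟨Or.inr ⟨hy, h, h'⟩, by rwa [h2 hy] at h0⟩

/-- A pivot whose selection is due to `b` only reverses the pair `b`. -/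
theorem flip_eq_addArc (hG : G.SinksNonneg) (hb : IsExtension pri pri' b)
    (hp : IsOrientation pri' p) {i : G.Ran} (hi : G.Sel pri' p i)
    (h : ∀ j, G.FollowsIn p i j → pri s(i, j) = 0) :
    ∃ j, b = s(i, j) ∧ p = addArc (restrictTo pri p) i j ∧
      G.flip p i = addArc (restrictTo pri p) j i := by
  have hfol : ∀ j, G.FollowsIn p i j → s(i, j) = b := fun j hj => by
    by_contra hne
    exact hp.1 i j hj.1 (by rw [hb.eq_of_ne _ hne]; exact h j hj)
  obtain ⟨j, -, hj, he⟩ := hi.1.exists_rel hG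
  have hij := hfol j ⟨hj, he⟩
  have hne : i ≠ j := fun h => hp.irrefl i (h.symm ▸ hj)
  have hcase : ∀ x y, p x y → restrictTo pri p x y ∨ (x = i ∧ y = j) := by
    intro x y hxy
    by_cases h0 : pri s(x, y) = 0
    · right
      have : s(x, y) = s(i, j) := by
        by_contra hne'
        rw [hij] at hne'
        exact hp.1 x y hxy (by rw [hb.eq_of_ne _ hne']; exact h0)
      rcases Sym2.eq_iff.1 this with h | ⟨rfl, rfl⟩
      · exact h
      · exact absurd hxy (hp.asymm hj)
    · exact Or.inl ⟨hxy, h0⟩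
  have hfj : ∀ y, p i y → G.modVal p (.inr y) = G.modVal p (.inr i) → y = j := by
    intro y hy hv
    have := (hfol y ⟨hy, hv⟩).trans hij.symm
    rcases Sym2.eq_iff.1 this with h | h
    · exact h.2
    · exact absurd h.1 hne
  refine ⟨j, hij.symm, ?_, ?_⟩
  · funext x y
    refine propext ⟨hcase x y, ?_⟩
    rintro (h | ⟨rfl, rfl⟩)
    · exact h.1
    · exact hj
  · funext x y
    refine propext ⟨?_, ?_⟩
    · rintro (⟨hxy, hn⟩ | ⟨rfl, hx, hv⟩)
      · rcases hcase x y hxy with h | ⟨rfl, rfl⟩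
        · exact Or.inl h
        · exact absurd ⟨rfl, he⟩ hn
      · exact Or.inr ⟨hfj x hx hv, rfl⟩
    · rintro (⟨hxy, h0⟩ | ⟨rfl, rfl⟩)
      · refine Or.inl ⟨hxy, ?_⟩
        rintro ⟨rfl, hv⟩
        rw [hfj y hxy hv, hij] at h0
        exact h0 hb.zero
      · exact Or.inr ⟨rfl, hj, he⟩

theorem restrictTo_addArc {q : G.Ran → G.Ran → Prop} {i j : G.Ran} (h : pri s(i, j) = 0) :
    restrictTo pri (addArc (restrictTo pri q) i j) = restrictTo pri q := by
  funext x y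
  refine propext ⟨?_, fun h => ⟨Or.inl h, h.2⟩⟩
  rintro ⟨h1 | ⟨rfl, rfl⟩, h2⟩
  · exact h1
  · exact absurd h h2

theorem mem_freePairs {u : WithBot (V ⊕ G.Ran → ℝ)} {c : Sym2 G.Ran} :
    c ∈ G.freePairs pri u p ↔ ¬ c.IsDiag ∧ pri c = 0 ∧
      ∀ x y, c = s(x, y) → u < ((G.modVal (addArc p x y) : V ⊕ G.Ran → ℝ) : WithBot _) := by
  simp [freePairs]

theorem modVal_addArc_le (hG : G.SinksNonneg) (x y : G.Ran) :
    G.modVal (addArc p x y) ≤ G.modVal (addArc (restrictTo pri p) x y) :=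
  modVal_antitone hG fun _ _ _ h => h.imp_left fun h => h.1

open Classical in
theorem freePairs_subset (hG : G.SinksNonneg) (hb : IsExtension pri pri' b)
    (u : WithBot (V ⊕ G.Ran → ℝ)) : G.freePairs pri' u p ⊆
      (G.freePairs pri u (restrictTo pri p)).erase b := by
  intro c hc
  rw [mem_freePairs] at hc
  have hcb : c ≠ b := fun h => hb.ne_zero (h ▸ hc.2.1)
  rw [Finset.mem_erase, mem_freePairs]
  refine ⟨hcb, hc.1, by rw [← hb.eq_of_ne c hcb]; exact hc.2.1, fun x y hxy => ?_⟩
  exact (hc.2.2 x y hxy).trans_le (WithBot.coe_le_coe.2 (modVal_addArc_le hG x y))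

open Classical in
theorem facetBound_freePairs_le (hG : G.SinksNonneg) (hb : IsExtension pri pri' b)
    (u : WithBot (V ⊕ G.Ran → ℝ)) : facetBound (G.freePairs pri' u p).card ≤
      G.splitCost pri b u (restrictTo pri p) := by
  have h := Finset.card_le_card (freePairs_subset (p := p) hG hb u)
  unfold splitCost
  split_ifs with hm
  · rw [Finset.card_erase_of_mem hm] at h
    exact (facetBound_mono h).trans (le_add_of_nonneg_right (facetBound_nonneg _))
  · rw [Finset.erase_eq_of_notMem hm] at h
    exact facetBound_mono h

theorem coe_modVal_lt_flip (hG : G.SinksNonneg) {i : G.Ran} (hi : G.Sel pri p i) :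
    ((G.modVal p : V ⊕ G.Ran → ℝ) : WithBot (V ⊕ G.Ran → ℝ)) <
      ((G.modVal (G.flip p i) : V ⊕ G.Ran → ℝ) : WithBot _) :=
  WithBot.coe_lt_coe.2 (modVal_lt_flip hG hi.1)

/-- When the pair `b` gets a nonzero priority, every step of the run is replaced by at most two
steps, before and after a reversal of `b`; the free pairs are as described by `splitCost`. -/
theorem runCost_le_runSplitCost (hG : G.SinksNonneg) (hb : IsExtension pri pri' b)
    (hpri : IsPriority pri') (n : ℕ) (u : WithBot (V ⊕ G.Ran → ℝ)) (hp : IsOrientation pri' p)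
    (hu : u < ((G.modVal p : V ⊕ G.Ran → ℝ) : WithBot _)) :
    G.runCost pri' n u p ≤ G.runSplitCost pri b n u (restrictTo pri p) := by
  classical
  induction n using Nat.strong_induction_on generalizing u p with
  | _ n ih =>
  have hpri₀ := hb.isPriority hpri
  -- A step that is not caused by `b`: the run that ignores `b` makes the same step.
  have step : ∀ (m : ℕ) (u : WithBot (V ⊕ G.Ran → ℝ)) (p : G.Ran → G.Ran → Prop) (i j : G.Ran),
      m < n → IsOrientation pri' p → G.Sel pri' p i → G.FollowsIn p i j → pri s(i, j) ≠ 0 →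
      G.splitCost pri b u (restrictTo pri p) + G.runCost pri' m (G.modVal p) (G.flip p i) ≤
        G.runSplitCost pri b (m + 1) u (restrictTo pri p) := by
    intro m u p i j hm hp hi hj h0
    obtain ⟨h1, h2, h3⟩ := sel_restrictTo hG hb hp hi hj h0
    rw [runSplitCost_succ_of_sel hpri₀ (hb.isOrientation hp) h2, h1, ← h3]
    gcongr
    exact ih m hm _ (hp.flip i) (coe_modVal_lt_flip hG hi)
  cases n with
  | zero => simp [runCost, runSplitCost]
  | succ n =>
  by_cases hsel : ∃ i, G.Sel pri' p i
  swap
  · rw [runCost_succ_of_not_sel hsel]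
    exact (facetBound_freePairs_le hG hb u).trans (splitCost_le_runSplitCost b n u)
  obtain ⟨i, hi⟩ := hsel
  rw [runCost_succ_of_sel hpri hp hi]
  by_cases hE : ∃ j, G.FollowsIn p i j ∧ pri s(i, j) ≠ 0
  · obtain ⟨j, hj, h0⟩ := hE
    refine le_trans ?_ (step n u p i j (Nat.lt_succ_self n) hp hi hj h0)
    gcongr
    exact facetBound_freePairs_le hG hb u
  push Not at hE
  obtain ⟨j, hbj, hpq, hpq'⟩ := flip_eq_addArc hG hb hp hi hE
  set q := restrictTo pri p with hq
  have hlt := modVal_lt_flip hG hi.1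
  have hp' := hp.flip i
  have hq' : restrictTo pri (G.flip p i) = q := by
    rw [hpq', hq]
    exact restrictTo_addArc (by rw [Sym2.eq_swap, ← hbj]; exact hb.zero)
  have hbF : b ∈ G.freePairs pri u q := by
    rw [mem_freePairs]
    refine ⟨hb.not_isDiag, hb.zero, fun x y hxy => ?_⟩
    rcases Sym2.eq_iff.1 (hbj.symm.trans hxy) with ⟨rfl, rfl⟩ | ⟨rfl, rfl⟩
    · rwa [← hpq]
    · rw [← hpq']
      exact hu.trans (WithBot.coe_lt_coe.2 hlt)
  have hsplit : facetBound (G.freePairs pri' u p).card +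
      facetBound (G.freePairs pri' (G.modVal p : V ⊕ G.Ran → ℝ) (G.flip p i)).card ≤
        G.splitCost pri b u q := by
    rw [splitCost, if_pos hbF]
    refine add_le_add (facetBound_mono ?_) (facetBound_mono (Finset.card_le_card fun c hc => ?_))
    · rw [← Finset.card_erase_of_mem hbF]
      exact Finset.card_le_card (freePairs_subset hG hb u)
    · have hc' := freePairs_subset hG hb _ hc
      rw [hq', Finset.mem_erase, mem_freePairs] at hc'
      rw [Finset.mem_filter, mem_freePairs]
      refine ⟨⟨hc'.2.1, hc'.2.2.1, fun x y hxy => hu.trans (hc'.2.2.2 x y hxy)⟩,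
        i, j, hbj, fun x y hxy => ?_⟩
      rw [← hpq]
      exact WithBot.coe_lt_coe.1 (hc'.2.2.2 x y hxy)
  cases n with
  | zero =>
    refine le_trans ?_ (splitCost_le_runSplitCost b 0 u)
    simp only [runCost, add_zero]
    exact le_trans (le_add_of_nonneg_right (facetBound_nonneg _)) hsplit
  | succ m =>
  by_cases hsel' : ∃ i', G.Sel pri' (G.flip p i) i'
  swap
  · rw [runCost_succ_of_not_sel hsel']
    exact hsplit.trans (splitCost_le_runSplitCost b _ u)
  obtain ⟨i', hi'⟩ := hsel'
  rw [runCost_succ_of_sel hpri hp' hi', ← add_assoc]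
  by_cases hE' : ∃ j', G.FollowsIn (G.flip p i) i' j' ∧ pri s(i', j') ≠ 0
  · obtain ⟨j', hj', h0⟩ := hE'
    have h1 := step m u (G.flip p i) i' j' (by omega) hp' hi' hj' h0
    rw [hq'] at h1
    refine le_trans ?_ (h1.trans (runSplitCost_le_succ b _ u))
    gcongr
  · -- A second reversal of `b` would lead back to `p`, although the values have increased.
    push Not at hE'
    obtain ⟨j', hbj', h1, h2⟩ := flip_eq_addArc hG hb hp' hi' hE'
    rw [hq'] at h1 h2
    have hlt' := modVal_lt_flip hG hi'.1
    rcases Sym2.eq_iff.1 (hbj.symm.trans hbj') with ⟨rfl, rfl⟩ | ⟨rfl, rfl⟩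
    · rw [← hpq] at h1
      rw [h1] at hlt
      exact absurd hlt (lt_irrefl _)
    · rw [h2, ← hpq] at hlt'
      exact absurd (hlt.trans hlt') (lt_irrefl _)

open Classical in
/-- The averaging step: a uniformly random new pair does not increase the expected cost. -/
theorem sum_splitCost_le (u : WithBot (V ⊕ G.Ran → ℝ)) (Z : Finset (Sym2 G.Ran))
    (hZ : ∀ e, e ∈ Z ↔ ¬ e.IsDiag ∧ pri e = 0) :
    ∑ b ∈ Z, G.splitCost pri b u p ≤ Z.card * facetBound (G.freePairs pri u p).card := by
  set F := G.freePairs pri u p with hF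
  have hFZ : F ⊆ Z := fun c hc => by
    rw [hF, mem_freePairs] at hc
    exact (hZ c).2 ⟨hc.1, hc.2.1⟩
  have h1 : ∑ b ∈ Z \ F, G.splitCost pri b u p = ((Z.card : ℝ) - F.card) * facetBound F.card := by
    have h0 : ∀ b ∈ Z \ F, G.splitCost pri b u p = facetBound F.card := fun b hb => by
      rw [splitCost, if_neg (Finset.mem_sdiff.1 hb).2]
    rw [Finset.sum_congr rfl h0, Finset.sum_const,
      Finset.card_sdiff_of_subset hFZ, nsmul_eq_mul, Nat.cast_sub (Finset.card_le_card hFZ)]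
  have h2 : ∑ b ∈ F, G.splitCost pri b u p ≤ F.card * facetBound F.card := by
    have h0 : ∀ b ∈ F, G.splitCost pri b u p =
        facetBound (F.card - 1) + facetBound (F.filter (G.PairLT p b)).card := fun b hb => by
      rw [splitCost, if_pos hb]
    rw [Finset.sum_congr rfl h0, Finset.sum_add_distrib, Finset.sum_const,
      nsmul_eq_mul]
    have h3 := sum_facetBound_card_le (G.PairLT p) (PairLT.irrefl p) (PairLT.trans p) F
    cases hn : F.card with
    | zero => simp [Finset.card_eq_zero.1 hn]
    | succ m =>
      rw [hn] at h3
      have := succ_mul_facetBound m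
      push_cast
      linarith
  rw [← Finset.sum_sdiff hFZ, h1]
  linarith

theorem sum_runSplitCost_le (n : ℕ) (u : WithBot (V ⊕ G.Ran → ℝ)) (Z : Finset (Sym2 G.Ran))
    (hZ : ∀ e, e ∈ Z ↔ ¬ e.IsDiag ∧ pri e = 0) :
    ∑ b ∈ Z, G.runSplitCost pri b n u p ≤ Z.card * G.runCost pri n u p := by
  induction n generalizing u p with
  | zero => simp [runSplitCost, runCost]
  | succ n ih =>
    simp only [runSplitCost, runCost]
    rw [Finset.sum_add_distrib, mul_add]
    refine add_le_add (sum_splitCost_le u Z hZ) ?_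
    split_ifs with h
    · exact ih _
    · simp

end Split

/-! ### The expected number of pivots -/

section Average

variable {V : Type*} [Fintype V] {G : SSG V}

open Classical in
/-- The priorities of the pairs that are not among the first `s` pairs of `Θ`. -/
def pairPriority (Θ : PairOrder G.Ran) (s : ℕ) (e : Sym2 G.Ran) : ℕ :=
  if h : ¬ e.IsDiag then if s ≤ (Θ ⟨e, h⟩ : ℕ) then (Θ ⟨e, h⟩ : ℕ) + 1 else 0 else 0

variable (Θ : PairOrder G.Ran) (s : ℕ)

theorem pairPriority_ne_zero {e : Sym2 G.Ran} :
    pairPriority Θ s e ≠ 0 ↔ ∃ h : ¬ e.IsDiag, s ≤ (Θ ⟨e, h⟩ : ℕ) := by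
  unfold pairPriority
  split_ifs with h h' <;> simp_all

theorem pairPriority_of_le {e : Sym2 G.Ran} (h : ¬ e.IsDiag) (h' : s ≤ (Θ ⟨e, h⟩ : ℕ)) :
    pairPriority Θ s e = (Θ ⟨e, h⟩ : ℕ) + 1 := by
  rw [pairPriority, dif_pos h, if_pos h']

theorem isPriority_pairPriority : IsPriority (pairPriority Θ s) := by
  intro e e' h he
  obtain ⟨h1, h2⟩ := (pairPriority_ne_zero Θ s).1 h
  obtain ⟨h3, h4⟩ := (pairPriority_ne_zero Θ s).1 (he ▸ h)
  rw [pairPriority_of_le Θ s h1 h2, pairPriority_of_le Θ s h3 h4] at he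
  exact congrArg Subtype.val (Θ.injective (Fin.ext (Nat.add_right_cancel he)))

theorem isOrientation_restrictTo (t : TotalOrder G.Ran) :
    IsOrientation (pairPriority Θ s) (restrictTo (pairPriority Θ s) t.rel) := by
  refine ⟨fun a b h => h.2, fun a b h => ?_⟩
  obtain ⟨h1, -⟩ := (pairPriority_ne_zero Θ s).1 h
  have h2 : a ≠ b := by simpa using h1
  constructor
  · exact fun h3 h4 => h2 (t.antisymm a b h3.1 h4.1)
  · intro h3
    refine ⟨(t.total a b).resolve_right fun h4 => h3 ⟨h4, ?_⟩, h⟩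
    rwa [Sym2.eq_swap]

/-- Exchange of the pair at position `s` of `Θ` with an earlier one, at position `l`. -/
theorem isExtension_pairPriority {s l : Fin (Nat.card (Pairs G.Ran))} (hl : l ≤ s) :
    IsExtension (pairPriority Θ (s + 1)) (pairPriority (Θ.trans (Equiv.swap s l)) s)
      (Θ.symm l).1 := by
  have hb : ∀ h, Θ ⟨(Θ.symm l).1, h⟩ = l := fun h => Θ.apply_symm_apply l
  have hval : pairPriority (Θ.trans (Equiv.swap s l)) s (Θ.symm l).1 = s + 1 := by
    rw [pairPriority_of_le _ _ (Θ.symm l).2] <;> simp [hb]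
  refine ⟨(Θ.symm l).2, ?_, by rw [hval]; omega, fun e he => ?_, fun e he => ?_⟩
  · by_contra h
    obtain ⟨h1, h2⟩ := (pairPriority_ne_zero Θ (s + 1)).1 h
    rw [hb h1] at h2
    have : (l : ℕ) ≤ s := hl
    omega
  · by_cases hd : e.IsDiag
    · simp [pairPriority, hd]
    have h4 : Θ ⟨e, hd⟩ ≠ l := fun h => he (by rw [← h]; simp)
    unfold pairPriority
    rw [dif_pos hd, dif_pos hd, Equiv.trans_apply]
    by_cases h3 : Θ ⟨e, hd⟩ = s
    · have h5 : ¬ (s : ℕ) ≤ l := fun h => h4 (h3.trans (le_antisymm h hl))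
      rw [h3, Equiv.swap_apply_left, if_neg h5, if_neg (by omega)]
    · have h5 : (Θ ⟨e, hd⟩ : ℕ) ≠ s := fun h => h3 (Fin.ext h)
      rw [Equiv.swap_apply_of_ne_of_ne h3 h4]
      split_ifs <;> omega
  · obtain ⟨h1, h2⟩ := (pairPriority_ne_zero Θ (s + 1)).1 he
    rw [hval, pairPriority_of_le Θ _ h1 h2]
    omega

theorem restrictTo_restrictTo {pri pri' : Sym2 G.Ran → ℕ} {b : Sym2 G.Ran}
    (hb : IsExtension pri pri' b) (p : G.Ran → G.Ran → Prop) :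
    restrictTo pri (restrictTo pri' p) = restrictTo pri p := by
  funext x y
  refine propext ⟨fun h => ⟨h.1.1, h.2⟩, fun h => ⟨⟨h.1, ?_⟩, h.2⟩⟩
  rw [hb.eq_of_ne _ (hb.ne h.2)]
  exact h.2

/-- The cost of the run of the algorithm that ignores the first `s` pairs of `Θ`. -/
def levelCost (t : TotalOrder G.Ran) (n : ℕ) : ℝ :=
  G.runCost (pairPriority Θ s) n ⊥ (restrictTo (pairPriority Θ s) t.rel)

open Classical in
/-- The average of the cost does not increase when one more pair is taken into account: given the
pairs after the position `s`, the pair at that position is uniform among the others. -/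
theorem sum_levelCost_le (hG : G.SinksNonneg) (t : TotalOrder G.Ran) (n : ℕ)
    (s : Fin (Nat.card (Pairs G.Ran))) :
    ∑ Θ : PairOrder G.Ran, levelCost Θ s t n ≤ ∑ Θ : PairOrder G.Ran, levelCost Θ (s + 1) t n := by
  let L := Finset.univ.filter fun l : Fin (Nat.card (Pairs G.Ran)) => l ≤ s
  have hL : (L.card : ℝ) = s + 1 := by
    have : L = Finset.Iic s := by ext; simp [L]
    rw [this, Fin.card_Iic]
    push_cast
    rfl
  have h1 : ∀ l, ∑ Θ : PairOrder G.Ran, levelCost (Θ.trans (Equiv.swap s l)) s t n =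
      ∑ Θ : PairOrder G.Ran, levelCost Θ s t n := fun l => by
    have hinv : Function.Involutive fun Θ : PairOrder G.Ran => Θ.trans (Equiv.swap s l) :=
      fun Θ => by ext; simp
    exact hinv.bijective.sum_comp fun Θ => levelCost Θ s t n
  have h2 : ∀ Θ : PairOrder G.Ran, ∑ l ∈ L, levelCost (Θ.trans (Equiv.swap s l)) s t n ≤
      (s + 1) * levelCost Θ (s + 1) t n := by
    intro Θ
    have hinj : Set.InjOn (fun l => (Θ.symm l).1) L := fun l _ l' _ h =>
      Θ.symm.injective (Subtype.ext h)
    have h3 := sum_runSplitCost_le (G := G) (pri := pairPriority Θ (s + 1))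
      (p := restrictTo (pairPriority Θ (s + 1)) t.rel) n ⊥ (L.image fun l => (Θ.symm l).1) ?_
    · rw [Finset.sum_image hinj, Finset.card_image_of_injOn hinj, hL] at h3
      refine le_trans (Finset.sum_le_sum fun l hl => ?_) h3
      have hext := isExtension_pairPriority Θ (s := s) (l := l) (by simpa [L] using hl)
      rw [← restrictTo_restrictTo hext]
      exact runCost_le_runSplitCost hG hext (isPriority_pairPriority _ _) n ⊥
        (isOrientation_restrictTo _ _ t) (WithBot.bot_lt_coe _)
    · intro e
      simp only [Finset.mem_image, L, Finset.mem_filter, Finset.mem_univ, true_and]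
      constructor
      · rintro ⟨l, hl, rfl⟩
        exact ⟨(Θ.symm l).2, (isExtension_pairPriority Θ hl).zero⟩
      · rintro ⟨hd, h0⟩
        refine ⟨Θ ⟨e, hd⟩, ?_, by simp⟩
        by_contra hlt
        refine (pairPriority_ne_zero Θ (s + 1)).2 ⟨hd, ?_⟩ h0
        have : (s : ℕ) < Θ ⟨e, hd⟩ := not_le.1 hlt
        omega
  have h3 : ((s : ℝ) + 1) * ∑ Θ : PairOrder G.Ran, levelCost Θ s t n ≤
      (s + 1) * ∑ Θ : PairOrder G.Ran, levelCost Θ (s + 1) t n := by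
    calc ((s : ℝ) + 1) * ∑ Θ : PairOrder G.Ran, levelCost Θ s t n
        = ∑ l ∈ L, ∑ Θ : PairOrder G.Ran, levelCost (Θ.trans (Equiv.swap s l)) s t n := by
          rw [Finset.sum_congr rfl fun l _ => h1 l, Finset.sum_const, nsmul_eq_mul, hL]
      _ = ∑ Θ : PairOrder G.Ran, ∑ l ∈ L, levelCost (Θ.trans (Equiv.swap s l)) s t n :=
          Finset.sum_comm
      _ ≤ _ := by
          rw [Finset.mul_sum]
          exact Finset.sum_le_sum fun Θ _ => h2 Θ
  exact le_of_mul_le_mul_left h3 (by positivity)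

theorem card_pairs : Nat.card (Pairs G.Ran) = (Fintype.card G.Ran).choose 2 := by
  classical
  rw [Nat.card_eq_fintype_card]
  exact Sym2.card_subtype_not_diag

theorem levelCost_card_le (hG : G.SinksNonneg) (t : TotalOrder G.Ran) (n : ℕ) :
    levelCost Θ (Nat.card (Pairs G.Ran)) t n ≤ facetBound (Nat.card (Pairs G.Ran)) := by
  classical
  have h0 : ∀ e, pairPriority Θ (Nat.card (Pairs G.Ran)) e = 0 := fun e => by
    by_contra h
    obtain ⟨h1, h2⟩ := (pairPriority_ne_zero Θ _).1 h
    exact absurd (Θ ⟨e, h1⟩).2 (not_lt.2 h2)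
  unfold levelCost
  cases n with
  | zero => exact facetBound_nonneg _
  | succ n =>
    rw [runCost_succ_of_not_sel]
    · refine facetBound_mono ?_
      rw [Nat.card_eq_fintype_card, Fintype.card_subtype]
      refine Finset.card_le_card fun c hc => ?_
      simpa using (mem_freePairs.1 hc).1
    · rintro ⟨i, hi⟩
      obtain ⟨j, -, hj, -⟩ := hi.1.exists_rel hG
      exact hj.2 (h0 _)

open Classical in
theorem sum_levelCost_zero_le (hG : G.SinksNonneg) (t : TotalOrder G.Ran) (n : ℕ) :
    ∑ Θ : PairOrder G.Ran, levelCost Θ 0 t n ≤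
      Fintype.card (PairOrder G.Ran) * Real.exp (√2 * Fintype.card G.Ran) := by
  have h1 : ∀ s, s ≤ Nat.card (Pairs G.Ran) → ∑ Θ : PairOrder G.Ran, levelCost Θ 0 t n ≤
      ∑ Θ : PairOrder G.Ran, levelCost Θ s t n := by
    intro s
    induction s with
    | zero => exact fun _ => le_rfl
    | succ s ih => exact fun hs => (ih (by omega)).trans (sum_levelCost_le hG t n ⟨s, hs⟩)
  refine (h1 _ le_rfl).trans ((Finset.sum_le_sum fun Θ _ => levelCost_card_le Θ hG t n).trans ?_)
  rw [Finset.sum_const, nsmul_eq_mul, Finset.card_univ]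
  refine mul_le_mul_of_nonneg_left ((facetBound_le_exp _).trans (Real.exp_le_exp.2 ?_))
    (Nat.cast_nonneg _)
  refine (pow_le_pow_iff_left₀ (by positivity) (by positivity) two_ne_zero).1 ?_
  rw [mul_pow, mul_pow, Real.sq_sqrt (Nat.cast_nonneg _), Real.sq_sqrt (by norm_num), card_pairs,
    Nat.cast_choose_two]
  have : (0 : ℝ) ≤ Fintype.card G.Ran := Nat.cast_nonneg _
  linarith

end Average

/-! ### Runs of the algorithm -/

section Runs

variable {V : Type*} [Fintype V] {G : SSG V} (Θ : PairOrder G.Ran) (t : TotalOrder G.Ran)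

/-- The relation of `t` outside the diagonal. -/
abbrev strictRel : G.Ran → G.Ran → Prop := restrictTo (pairPriority Θ 0) t.rel

theorem strictRel_iff {i j : G.Ran} : strictRel Θ t i j ↔ i ≠ j ∧ t.rel i j := by
  unfold strictRel restrictTo
  rw [pairPriority_ne_zero]
  simp [and_comm]

theorem modVal_strictRel (hG : G.SinksNonneg) : G.modVal (strictRel Θ t) = G.modVal t.rel :=
  modVal_congr hG fun i j hij => by simp [strictRel_iff, hij]

theorem constr_strictRel (hG : G.SinksNonneg) (i : G.Ran) :
    G.Constr (strictRel Θ t) i ↔ G.IsConstrained t i := by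
  rw [Constr, modVal_strictRel Θ t hG]
  rfl

theorem followsIn_strictRel (hG : G.SinksNonneg) (i j : G.Ran) :
    G.FollowsIn (strictRel Θ t) i j ↔ G.Follows t i j := by
  rw [FollowsIn, modVal_strictRel Θ t hG, strictRel_iff, and_assoc]
  rfl

theorem sel_strictRel (hG : G.SinksNonneg) (i : G.Ran) :
    G.Sel (pairPriority Θ 0) (strictRel Θ t) i ↔ G.IsSelected Θ t i := by
  have hpri : ∀ i j (h : i ≠ j), pairPriority Θ 0 s(i, j) = (Θ (pairOf h) : ℕ) + 1 :=
    fun i j h => pairPriority_of_le Θ 0 (by simpa using h) (Nat.zero_le _)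
  unfold Sel IsSelected
  simp only [constr_strictRel Θ t hG, followsIn_strictRel Θ t hG]
  refine and_congr_right fun _ => forall₂_congr fun i' _ => exists_congr fun j' => ?_
  constructor
  · rintro ⟨h', h⟩
    refine ⟨h', fun j hj => ?_⟩
    have := h j hj
    rw [hpri _ _ hj.1, hpri _ _ h'.1] at this
    exact Nat.le_of_add_le_add_right this
  · rintro ⟨h', h⟩
    refine ⟨h', fun j hj => ?_⟩
    rw [hpri _ _ hj.1, hpri _ _ h'.1]
    exact Nat.add_le_add_right (h j hj) 1

/-- Pivoting reverses the arcs from `i` to the control nodes of the same value. The order `t` being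
compatible with the values, these are all the arcs from `i` to a node of its value interval. -/
theorem strictRel_pivot (hG : G.SinksNonneg) (i : G.Ran) :
    strictRel Θ (t.pivot (G.controlVal t) i) = G.flip (strictRel Θ t) i := by
  have hmono : ∀ a b, t.rel a b → G.controlVal t a ≤ G.controlVal t b := fun a b h => by
    by_cases hab : b = a
    · rw [hab]
    · exact modVal_le_of_rel hG hab h
  have hup : ∀ b, t.rel i b →
      (t.upToInterval (G.controlVal t) i b ↔ G.controlVal t b = G.controlVal t i) := fun b hb =>
    ⟨fun ⟨l, hl, hbl⟩ => le_antisymm ((hmono b l hbl).trans hl.le) (hmono i b hb),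
      fun h => ⟨b, h, t.refl b⟩⟩
  have hup' : ∀ b, t.rel b i → t.upToInterval (G.controlVal t) i b := fun b hb => ⟨i, rfl, hb⟩
  have hv : ∀ a, G.modVal t.rel (.inr a) = G.controlVal t a := fun a => rfl
  funext a b
  simp only [SSG.flip, strictRel_iff, modVal_strictRel Θ t hG, hv, TotalOrder.pivot, eq_iff_iff]
  by_cases ha : a = i
  · subst ha
    by_cases hb : b = a
    · subst hb; simp
    · simp only [true_and, hb, false_or, ne_eq, not_true_eq_false, false_and, or_false]
      constructor
      · rintro ⟨h1, h2⟩
        have hab : t.rel a b := (t.total a b).resolve_right fun h => h2 (hup' b h)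
        exact ⟨⟨h1, hab⟩, fun h => h2 ((hup b hab).2 h)⟩
      · rintro ⟨⟨h1, h2⟩, h3⟩
        exact ⟨h1, fun h => h3 ((hup b h2).1 h)⟩
  · by_cases hb : b = i
    · subst hb
      simp only [ha, false_and, ne_eq, not_false_eq_true, not_true_eq_false, true_and, and_true,
        or_false, false_or]
      constructor
      · intro h
        by_cases hab : t.rel a b
        · exact Or.inl hab
        · have hba := (t.total a b).resolve_left hab
          exact Or.inr ⟨⟨fun h => ha h.symm, hba⟩, (hup a hba).1 h⟩
      · rintro (h | ⟨⟨_, h1⟩, h2⟩)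
        · exact hup' a h
        · exact (hup a h1).2 h2
    · simp [ha, hb]

theorem one_le_facetBound (n : ℕ) : 1 ≤ facetBound n := by
  rw [← facetBound_zero]
  exact facetBound_mono (Nat.zero_le n)

/-- The cost counts at least one for each order that the algorithm visits. -/
theorem le_runCost_or_exists_run (hG : G.SinksNonneg) (n : ℕ) (u : WithBot (V ⊕ G.Ran → ℝ)) :
    (n : ℝ) ≤ G.runCost (pairPriority Θ 0) n u (strictRel Θ t) ∨
      ∃ N t', G.Run Θ t N t' ∧ (N : ℝ) + 1 ≤ G.runCost (pairPriority Θ 0) n u (strictRel Θ t) := by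
  induction n generalizing u t with
  | zero => simp [runCost]
  | succ n ih =>
    by_cases hsel : ∃ i, G.Sel (pairPriority Θ 0) (strictRel Θ t) i
    · obtain ⟨i, hi⟩ := hsel
      rw [runCost_succ_of_sel (isPriority_pairPriority Θ 0) (isOrientation_restrictTo Θ 0 t) hi,
        ← strictRel_pivot Θ t hG i]
      have h1 := one_le_facetBound (G.freePairs (pairPriority Θ 0) u (strictRel Θ t)).card
      rcases ih (t.pivot (G.controlVal t) i) (G.modVal (strictRel Θ t) : V ⊕ G.Ran → ℝ) with
        h | ⟨N, t', h, h'⟩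
      · left
        push_cast
        linarith
      · refine Or.inr ⟨N + 1, t', .pivot t i N t' ((sel_strictRel Θ t hG i).1 hi) h, ?_⟩
        push_cast
        linarith
    · refine Or.inr ⟨0, t, .done t fun i hi => hsel ?_, ?_⟩
      · exact exists_sel hG ((constr_strictRel Θ t hG i).2 hi)
      · rw [runCost_succ_of_not_sel hsel]
        simpa using one_le_facetBound _

variable {Θ t}

theorem Run.unique {n n' : ℕ} {t₁ t₂ : TotalOrder G.Ran} (h : G.Run Θ t n t₁)
    (h' : G.Run Θ t n' t₂) : n = n' ∧ t₁ = t₂ := by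
  induction h generalizing n' t₂ with
  | done t h =>
    cases h' with
    | done => exact ⟨rfl, rfl⟩
    | pivot _ i _ _ hi => exact absurd hi.1 (h i)
  | pivot t i n t' hi _ ih =>
    cases h' with
    | done _ h => exact absurd hi.1 (h i)
    | pivot _ i' m _ hi' h' =>
      obtain rfl := hi.unique hi'
      obtain ⟨rfl, rfl⟩ := ih h'
      exact ⟨rfl, rfl⟩

theorem Run.not_isConstrained {n : ℕ} {t' : TotalOrder G.Ran} (h : G.Run Θ t n t') (i : G.Ran) :
    ¬ G.IsConstrained t' i := by
  induction h with
  | done t h => exact h i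
  | pivot _ _ _ _ _ _ ih => exact ih

theorem runCost_nonneg (pri : Sym2 G.Ran → ℕ) (n : ℕ) (u : WithBot (V ⊕ G.Ran → ℝ))
    (p : G.Ran → G.Ran → Prop) : 0 ≤ G.runCost pri n u p := by
  induction n generalizing u p with
  | zero => exact le_rfl
  | succ n ih =>
    rw [runCost]
    split_ifs
    · exact add_nonneg (facetBound_nonneg _) (ih _ _)
    · exact add_nonneg (facetBound_nonneg _) le_rfl

open Classical in
/-- The algorithm terminates, since the cost of its first `n` steps is bounded independently of
`n`, and this bound also holds for the average number of pivots. -/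
theorem exists_run (hG : G.SinksNonneg) (t : TotalOrder G.Ran) :
    ∃ N : PairOrder G.Ran → ℕ, (∀ Θ, ∃ t', G.Run Θ t (N Θ) t') ∧
      (∑ Θ, (N Θ : ℝ)) / Fintype.card (PairOrder G.Ran) ≤
        Real.exp (√2 * Fintype.card G.Ran) := by
  obtain ⟨n, hn⟩ := exists_nat_gt
    (Fintype.card (PairOrder G.Ran) * Real.exp (√2 * Fintype.card G.Ran))
  have hsum := sum_levelCost_zero_le hG t n
  have h1 : ∀ Θ : PairOrder G.Ran, ∃ N t', G.Run Θ t N t' ∧ (N : ℝ) + 1 ≤ levelCost Θ 0 t n := by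
    intro Θ
    refine (le_runCost_or_exists_run Θ t hG n ⊥).resolve_left (not_le.2 ?_)
    exact (Finset.single_le_sum (f := fun Θ : PairOrder G.Ran => levelCost Θ 0 t n)
      (fun _ _ => runCost_nonneg _ _ _ _) (Finset.mem_univ Θ)).trans_lt (hsum.trans_lt hn)
  choose N t' hrun hN using h1
  refine ⟨N, fun Θ => ⟨t' Θ, hrun Θ⟩, ?_⟩
  refine div_le_of_le_mul₀ (Nat.cast_nonneg _) (Real.exp_pos _).le ?_
  rw [mul_comm]
  exact (Finset.sum_le_sum fun Θ _ => (lt_add_one (N Θ : ℝ)).le.trans (hN Θ)).trans hsum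

end Runs

end SSG

/-! ### Ranks in a total order -/

namespace TotalOrder

variable {ι : Type*} [Finite ι] (t : TotalOrder ι)

theorem rank_lt {i j : ι} (h : t.rel i j) (hij : i ≠ j) : t.rank i < t.rank j := by
  change Set.ncard {l | t.rel l i} < Set.ncard {l | t.rel l j}
  refine Set.ncard_lt_ncard ⟨fun l hl => t.trans _ _ _ hl h, fun hs => ?_⟩ (Set.toFinite _)
  exact hij (t.antisymm _ _ h (hs (t.refl j)))

theorem rank_le_iff {i j : ι} : t.rank i ≤ t.rank j ↔ t.rel i j := by
  by_cases hij : i = j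
  · simp [hij, t.refl]
  · refine ⟨fun h => (t.total i j).resolve_right fun h' => ?_, fun h => (t.rank_lt h hij).le⟩
    exact absurd (t.rank_lt h' (Ne.symm hij)) (not_lt.2 h)

theorem rank_pos (i : ι) : 0 < t.rank i := by
  change 0 < Set.ncard {l | t.rel l i}
  exact (Set.ncard_pos (Set.toFinite _)).2 ⟨i, t.refl i⟩

end TotalOrder

namespace SSG

/-! ### Forcing strategies -/

section Forcing

variable {V : Type*} [Fintype V] {G : SSG V}

theorem redirect_ran (i : G.Ran) : G.redirect i.1 = .inr i := by simp [redirect, i.2]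

theorem redirect_of_ne {y : V} (h : G.kind y ≠ .ran) : G.redirect y = .inl y := by
  simp [redirect, h]

theorem redirect_eq (G : SSG V) (y : V) :
    (∃ i : G.Ran, i.1 = y ∧ G.redirect y = .inr i) ∨ G.kind y ≠ .ran ∧ G.redirect y = .inl y := by
  by_cases h : G.kind y = .ran
  · exact Or.inl ⟨⟨y, h⟩, rfl, redirect_ran ⟨y, h⟩⟩
  · exact Or.inr ⟨h, redirect_of_ne h⟩

theorem sum_modified_prob (p : G.Ran → G.Ran → Prop) (x : V) (h : V ⊕ G.Ran → ℝ) :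
    ∑ z, ((G.modified p).prob (.inl x) z : ℝ) * h z =
      ∑ y, (G.prob x y : ℝ) * h (G.redirect y) := by
  have key : ∀ g : V → ℝ, ∑ j : G.Ran, g j.1 = ∑ y, if G.kind y = .ran then g y else 0 := by
    intro g
    rw [← Finset.sum_filter]
    exact (Finset.sum_subtype _ (by simp) g).symm
  have h1 : ∀ j : G.Ran, ((G.modified p).prob (.inl x) (.inr j) : ℝ) * h (.inr j) =
      (G.prob x j.1 : ℝ) * h (G.redirect j.1) := fun j => by rw [redirect_ran]; rfl
  rw [Fintype.sum_sum_type, Finset.sum_congr rfl fun j _ => h1 j,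
    key fun y => (G.prob x y : ℝ) * h (G.redirect y), ← Finset.sum_add_distrib]
  refine Finset.sum_congr rfl fun y _ => ?_
  have h2 : (G.modified p).prob (.inl x) (.inl y) = if G.kind y = .ran then 0 else G.prob x y := rfl
  by_cases hy : G.kind y = .ran
  · simp [h2, hy]
  · simp [h2, hy, redirect_of_ne hy]

variable (t : TotalOrder G.Ran)

theorem sinksNonneg_forcingGame : (G.forcingGame t).SinksNonneg := by
  rintro (x | i) _
  · exact le_rfl
  · exact Nat.cast_nonneg _

theorem forcingGame_kind_max {x : V} :
    (G.forcingGame t).kind (.inl x) = .max ↔ G.kind x = .max := by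
  change (if G.kind x = .ran then NodeKind.sink else G.kind x) = _ ↔ _
  split_ifs with h <;> simp [h]

theorem forcingGame_kind_min {x : V} :
    (G.forcingGame t).kind (.inl x) = .min ↔ G.kind x = .min := by
  change (if G.kind x = .ran then NodeKind.sink else G.kind x) = _ ↔ _
  split_ifs with h <;> simp [h]

theorem forcingGame_kind_ne_ran (z : V ⊕ G.Ran) : (G.forcingGame t).kind z ≠ .ran := by
  rcases z with x | i
  · change (if G.kind x = .ran then NodeKind.sink else G.kind x) ≠ _
    split_ifs with h
    · simp
    · exact h
  · exact NodeKind.noConfusion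

theorem forcingGame_arc {x : V} (hx : G.kind x = .max ∨ G.kind x = .min) {w : V ⊕ G.Ran} :
    (G.forcingGame t).arc (.inl x) w ↔ ∃ y, G.arc x y ∧ w = G.redirect y := by
  change (if G.kind x = .max ∨ G.kind x = .min then _ else _) ↔ _
  rw [if_pos hx]

/-- Every order has a pair of forcing strategies. -/
theorem exists_areForcing :
    ∃ (σ : G.MaxStrategy) (τ : G.MinStrategy), AreForcing t σ τ := by
  obtain ⟨σ', τ', -, hσ, hτ⟩ := exists_areOptimal (sinksNonneg_forcingGame t)
  have h1 : ∀ x : {x : V // G.kind x = .max}, ∃ y, G.arc x.1 y ∧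
      (σ' ⟨.inl x.1, (forcingGame_kind_max t).2 x.2⟩ : V ⊕ G.Ran) = G.redirect y := fun x =>
    (forcingGame_arc t (Or.inl x.2)).1 (σ' ⟨.inl x.1, (forcingGame_kind_max t).2 x.2⟩).2
  have h2 : ∀ x : {x : V // G.kind x = .min}, ∃ y, G.arc x.1 y ∧
      (τ' ⟨.inl x.1, (forcingGame_kind_min t).2 x.2⟩ : V ⊕ G.Ran) = G.redirect y := fun x =>
    (forcingGame_arc t (Or.inr x.2)).1 (τ' ⟨.inl x.1, (forcingGame_kind_min t).2 x.2⟩).2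
  choose s hs hs' using h1
  choose r hr hr' using h2
  refine ⟨fun x => ⟨s x, hs x⟩, fun x => ⟨r x, hr x⟩, ?_, ?_⟩
  · convert hσ using 1
    funext ⟨z, hz⟩
    rcases z with x | i
    · exact Subtype.ext (hs' ⟨x, (forcingGame_kind_max t).1 hz⟩).symm
    · exact nomatch hz
  · convert hτ using 1
    funext ⟨z, hz⟩
    rcases z with x | i
    · exact Subtype.ext (hr' ⟨x, (forcingGame_kind_min t).1 hz⟩).symm
    · exact nomatch hz

variable {t} {σ : G.MaxStrategy} {τ : G.MinStrategy}

theorem forcing_value_inr (i : G.Ran) : (G.forcingGame t).value (.inr i) = t.rank i := by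
  rw [(isOptimalityFixpoint_value (sinksNonneg_forcingGame t)).sink (.inr i) rfl]
  exact Rat.cast_natCast _

theorem forcing_value_max (hσ : IsMaxOptimal (liftMax t σ)) {x : V} (hx : G.kind x = .max) :
    (G.forcingGame t).value (G.redirect (σ ⟨x, hx⟩)) = (G.forcingGame t).value (.inl x) :=
  hσ.value_eq (sinksNonneg_forcingGame t) ((forcingGame_kind_max t).2 hx)

theorem forcing_value_min (hτ : IsMinOptimal (liftMin t τ)) {x : V} (hx : G.kind x = .min) :
    (G.forcingGame t).value (G.redirect (τ ⟨x, hx⟩)) = (G.forcingGame t).value (.inl x) :=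
  hτ.value_eq (sinksNonneg_forcingGame t) ((forcingGame_kind_min t).2 hx)

theorem forcing_value_le {x y : V} (hx : G.kind x = .max) (hy : G.arc x y) :
    (G.forcingGame t).value (G.redirect y) ≤ (G.forcingGame t).value (.inl x) :=
  (isOptimalityFixpoint_value (sinksNonneg_forcingGame t)).max_le _ _
    ((forcingGame_kind_max t).2 hx) ((forcingGame_arc t (Or.inl hx)).2 ⟨y, hy, rfl⟩)

theorem le_forcing_value {x y : V} (hx : G.kind x = .min) (hy : G.arc x y) :
    (G.forcingGame t).value (.inl x) ≤ (G.forcingGame t).value (G.redirect y) :=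
  (isOptimalityFixpoint_value (sinksNonneg_forcingGame t)).min_le _ _
    ((forcingGame_kind_min t).2 hx) ((forcingGame_arc t (Or.inr hx)).2 ⟨y, hy, rfl⟩)

open Classical in
/-- The greatest value in `G[t]` of a control node of rank at most `s`, and `0` if there is none. -/
def rankVal (G : SSG V) (t : TotalOrder G.Ran) (s : ℝ) : ℝ :=
  ((Finset.univ.filter fun i => (t.rank i : ℝ) ≤ s).sup
    fun i => (G.modVal t.rel (.inr i)).toNNReal : NNReal)

theorem rankVal_nonneg (s : ℝ) : 0 ≤ G.rankVal t s := NNReal.coe_nonneg _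

theorem rankVal_mono {s s' : ℝ} (h : s ≤ s') : G.rankVal t s ≤ G.rankVal t s' := by
  refine NNReal.coe_le_coe.2 (Finset.sup_mono fun i hi => ?_)
  simp only [Finset.mem_filter, Finset.mem_univ, true_and] at hi ⊢
  exact hi.trans h

theorem rankVal_zero : G.rankVal t 0 = 0 := by
  unfold rankVal
  rw [Finset.filter_false_of_mem fun i _ => not_le.2 (by exact_mod_cast t.rank_pos i)]
  simp

theorem rankVal_rank (hG : G.SinksNonneg) (i : G.Ran) :
    G.rankVal t (t.rank i) = G.modVal t.rel (.inr i) := by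
  have h0 : ∀ j, 0 ≤ G.modVal t.rel (.inr j) := fun j =>
    (isOptimalityFixpoint_modVal hG t.rel).nonneg _
  have h1 : (G.modVal t.rel (.inr i)).toNNReal = G.modVal t.rel (.inr i) :=
    Real.coe_toNNReal _ (h0 i)
  rw [← h1]
  refine congrArg _ (le_antisymm (Finset.sup_le fun j hj => Real.toNNReal_le_toNNReal ?_) ?_)
  · simp only [Finset.mem_filter, Finset.mem_univ, true_and, Nat.cast_le] at hj
    by_cases hij : i = j
    · rw [hij]
    · exact modVal_le_of_rel hG hij (t.rank_le_iff.1 hj)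
  · exact Finset.le_sup (f := fun i => (G.modVal t.rel (.inr i)).toNNReal) (by simp)

open Classical in
/-- The values that forcing strategies are expected to ensure in `G[t]`: at a max- or min-node,
the value of the control node whose rank is forced. -/
def forcedVal (G : SSG V) (t : TotalOrder G.Ran) : V ⊕ G.Ran → ℝ
  | .inl x => if G.kind x = .max ∨ G.kind x = .min then
      G.rankVal t ((G.forcingGame t).value (.inl x)) else G.modVal t.rel (.inl x)
  | .inr i => G.modVal t.rel (.inr i)

theorem forcedVal_of_maxmin {x : V} (h : G.kind x = .max ∨ G.kind x = .min) :
    G.forcedVal t (.inl x) = G.rankVal t ((G.forcingGame t).value (.inl x)) := if_pos h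

theorem forcedVal_of_not {x : V} (h : ¬ (G.kind x = .max ∨ G.kind x = .min)) :
    G.forcedVal t (.inl x) = G.modVal t.rel (.inl x) := if_neg h

theorem forcedVal_ran {x : V} (h : G.kind x = .ran) :
    G.forcedVal t (.inl x) = G.modVal t.rel (.inl x) := forcedVal_of_not (by simp [h])

theorem forcedVal_sink {x : V} (h : G.kind x = .sink) :
    G.forcedVal t (.inl x) = G.modVal t.rel (.inl x) := forcedVal_of_not (by simp [h])

theorem maxmin_of_ne {x : V} (h : G.kind x ≠ .ran) (h' : G.kind x ≠ .sink) :
    G.kind x = .max ∨ G.kind x = .min := by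
  cases h'' : G.kind x <;> simp_all

theorem forcedVal_redirect (hG : G.SinksNonneg) {y : V} (hy : G.kind y ≠ .sink) :
    G.forcedVal t (G.redirect y) = G.rankVal t ((G.forcingGame t).value (G.redirect y)) := by
  rcases G.redirect_eq y with ⟨i, rfl, h⟩ | ⟨h, h'⟩
  · rw [h, forcing_value_inr, rankVal_rank hG]
    rfl
  · rw [h', forcedVal_of_maxmin (maxmin_of_ne h hy)]

variable (hG : G.SinksNonneg)
  (harc : ∀ x y, (G.kind x = .max ∨ G.kind x = .min) → G.arc x y → G.kind y ≠ .sink)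

include hG harc

/-- In `G[t]`, a forcing strategy of min ensures `forcedVal`. -/
theorem modVal_le_forcedVal (hτ : IsMinOptimal (liftMin t τ)) (z : V ⊕ G.Ran) :
    G.modVal t.rel z ≤ G.forcedVal t z := by
  have F := isOptimalityFixpoint_modVal hG t.rel
  have hle : ∀ z, min (G.modVal t.rel z) (G.forcedVal t z) ≤ G.modVal t.rel z :=
    fun z => min_le_left _ _
  have : IsSuper (G.modified t.rel) fun z => min (G.modVal t.rel z) (G.forcedVal t z) := by
    refine ⟨fun z => le_min (F.nonneg z) ?_, ?_, ?_, ?_, ?_⟩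
    · rcases z with x | i
      · by_cases h : G.kind x = .max ∨ G.kind x = .min
        · rw [forcedVal_of_maxmin h]
          exact rankVal_nonneg _
        · rw [forcedVal_of_not h]
          exact F.nonneg _
      · exact F.nonneg (.inr i)
    · rintro (x | i) hz
      · rw [forcedVal_sink (G := G) hz, min_self]
        exact (F.sink (.inl x) hz).ge
      · cases hz
    · rintro (x | i) hz
      · rw [forcedVal_ran (G := G) hz, min_self, F.ran (.inl x) hz]
        refine Finset.sum_le_sum fun y _ => mul_le_mul_of_nonneg_left (hle y) ?_
        exact_mod_cast (G.modified t.rel).prob_nonneg (.inl x) y hz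
      · cases hz
    · rintro (x | i) w hz hw
      · have hx : G.kind x = .max := hz
        obtain ⟨y, hy, rfl⟩ := id hw
        refine min_le_min (F.max_le (.inl x) _ hz hw) ?_
        rw [forcedVal_redirect hG (harc x y (Or.inl hx) hy), forcedVal_of_maxmin (Or.inl hx)]
        exact rankVal_mono (forcing_value_le hx hy)
      · cases hz
    · rintro (x | i) hz
      · have hx : G.kind x = .min := hz
        rcases le_total (G.modVal t.rel (.inl x)) (G.forcedVal t (.inl x)) with h | h
        · obtain ⟨w, hw, he⟩ := F.min_ex (.inl x) hz
          exact ⟨w, hw, by rw [min_eq_left h, ← he]; exact hle w⟩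
        · refine ⟨G.redirect (τ ⟨x, hx⟩), ⟨_, (τ ⟨x, hx⟩).2, rfl⟩, ?_⟩
          rw [min_eq_right h]
          refine (min_le_right _ _).trans ?_
          rw [forcedVal_redirect hG (harc x _ (Or.inr hx) (τ ⟨x, hx⟩).2),
            forcedVal_of_maxmin (Or.inr hx), forcing_value_min hτ]
      · obtain ⟨w, hw, he⟩ := F.min_ex (.inr i) hz
        refine ⟨w, hw, (hle w).trans ?_⟩
        rw [he]
        exact le_min le_rfl le_rfl
  exact (this.value_le z).trans (min_le_right _ _)

omit hG harc in
/-- The strategy of max in `G[t]` that makes the same choices as `σ`. -/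
def redirectMax (t : TotalOrder G.Ran) (σ : G.MaxStrategy) : (G.modified t.rel).MaxStrategy
  | ⟨.inl x, h⟩ => ⟨G.redirect (σ ⟨x, h⟩), _, (σ ⟨x, h⟩).2, rfl⟩
  | ⟨.inr _, h⟩ => nomatch h

omit hG harc in
/-- The strategy of min in `G[t]` that makes the same choices as `τ`, and goes from each control
node to its random node. -/
def redirectMin (t : TotalOrder G.Ran) (τ : G.MinStrategy) : (G.modified t.rel).MinStrategy
  | ⟨.inl x, h⟩ => ⟨G.redirect (τ ⟨x, h⟩), _, (τ ⟨x, h⟩).2, rfl⟩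
  | ⟨.inr i, _⟩ => ⟨.inl i.1, Or.inl rfl⟩

omit hG harc in
/-- On a trap of `G[t]` for a forcing strategy of max, the rank that max can force is bounded by
the ranks of the control nodes of the trap. -/
theorem forcing_value_le_of_isTrap (hσ : IsMaxOptimal (liftMax t σ))
    {τ' : (G.modified t.rel).MinStrategy} {A : Set (V ⊕ G.Ran)}
    (hA : IsTrap (redirectMax t σ) τ' A) {R : ℝ} (hR : 0 ≤ R)
    (hAR : ∀ i, .inr i ∈ A → (t.rank i : ℝ) ≤ R) {z : V ⊕ G.Ran} (hz : z ∈ A) :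
    (G.forcingGame t).value z ≤ R := by
  classical
  let K : ℝ := R + ∑ i, (t.rank i : ℝ)
  have hRK : R ≤ K := le_add_of_nonneg_right (Finset.sum_nonneg fun i _ => Nat.cast_nonneg _)
  have hK : ∀ i, (t.rank i : ℝ) ≤ K := fun i =>
    (Finset.single_le_sum (f := fun i => (t.rank i : ℝ)) (fun _ _ => Nat.cast_nonneg _)
      (Finset.mem_univ i)).trans (le_add_of_nonneg_left hR)
  have hkind : ∀ x, (G.forcingGame t).kind (.inl x) = .min →
      (G.modified t.rel).kind (.inl x) = .min := fun x h => (forcingGame_kind_min t).1 h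
  let τ'' : (G.forcingGame t).MinStrategy := fun z => match z with
    | ⟨.inl x, h⟩ => ⟨τ' ⟨.inl x, hkind x h⟩,
        (forcingGame_arc t (Or.inr (hkind x h))).2 (τ' ⟨.inl x, hkind x h⟩).2⟩
    | ⟨.inr _, h⟩ => nomatch h
  have hstep : ∀ z w : V ⊕ G.Ran, (z ∈ A → w ∈ A) →
      (if w ∈ A then R else K) ≤ if z ∈ A then R else K := by
    intro z w h
    by_cases hz : z ∈ A
    · rw [if_pos hz, if_pos (h hz)]
    · rw [if_neg hz]
      split_ifs
      exacts [hRK, le_rfl]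
  have h := val_le_of_super' (liftMax t σ) τ'' (w := fun z => if z ∈ A then R else K)
    (fun z => by split_ifs; exacts [hR, hR.trans hRK]) ?_ ?_ ?_
    (fun z hz => absurd hz (forcingGame_kind_ne_ran t z)) z
  · refine (hσ.value_le_val τ'' z).trans (h.trans ?_)
    simp [hz]
  · rintro (x | i) _
    · have : ((G.forcingGame t).sinkVal (.inl x) : ℝ) = 0 := Rat.cast_zero
      rw [this]
      split_ifs
      exacts [hR, hR.trans hRK]
    · have : ((G.forcingGame t).sinkVal (.inr i) : ℝ) = t.rank i := Rat.cast_natCast _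
      rw [this]
      split_ifs with h
      exacts [hAR i h, hK i]
  · rintro (x | i) hx
    · exact hstep _ _ fun h => hA.max_mem h ((forcingGame_kind_max t).1 hx)
    · exact nomatch hx
  · rintro (x | i) hx
    · exact hstep _ _ fun h => hA.min_mem h ((forcingGame_kind_min t).1 hx)
    · exact nomatch hx

/-- Let `ρ` be a control node whose random node only leads to max- and min-nodes from which no rank
above that of `ρ` can be forced, and to control nodes of rank at most that of `ρ`. In `G[t]`, min can
return to `ρ` for ever, so that the value of `ρ` is `0`. -/
theorem modVal_eq_zero_of_return (hτ : IsMinOptimal (liftMin t τ)) (ρ : G.Ran)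
    (hρ : ∀ y, G.prob ρ.1 y ≠ 0 → G.kind y ≠ .sink ∧
      (G.forcingGame t).value (G.redirect y) ≤ t.rank ρ) :
    G.modVal t.rel (.inr ρ) = 0 := by
  classical
  have F := isOptimalityFixpoint_modVal hG t.rel
  let B : Set (V ⊕ G.Ran) := {z | z = .inl ρ.1 ∨ (∃ j, z = .inr j ∧ t.rank j ≤ t.rank ρ) ∨
    ∃ x, z = .inl x ∧ (G.kind x = .max ∨ G.kind x = .min) ∧
      (G.forcingGame t).value (.inl x) ≤ t.rank ρ}
  have hBinr : ∀ j, .inr j ∈ B ↔ t.rank j ≤ t.rank ρ := fun j => by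
    refine ⟨?_, fun h => Or.inr (Or.inl ⟨j, rfl, h⟩)⟩
    rintro (h | ⟨i, h, h'⟩ | ⟨x, h, -⟩)
    · exact absurd h Sum.inr_ne_inl
    · rwa [Sum.inr_injective h]
    · exact absurd h Sum.inr_ne_inl
  have hBinl : ∀ x, (.inl x : V ⊕ G.Ran) ∈ B → x = ρ.1 ∨ (G.kind x = .max ∨ G.kind x = .min) ∧
      (G.forcingGame t).value (.inl x) ≤ t.rank ρ := fun x => by
    rintro (h | ⟨i, h, -⟩ | ⟨x', h, h'⟩)
    · exact Or.inl (Sum.inl_injective h)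
    · exact absurd h Sum.inl_ne_inr
    · rw [← Sum.inl_injective h] at h'
      exact Or.inr h'
  have hBred : ∀ y, G.kind y ≠ .sink → (G.forcingGame t).value (G.redirect y) ≤ t.rank ρ →
      G.redirect y ∈ B := by
    intro y hy h
    rcases G.redirect_eq y with ⟨i, rfl, hi⟩ | ⟨hr, hi⟩
    · rw [hi, forcing_value_inr] at h
      rw [hi, hBinr]
      exact_mod_cast h
    · rw [hi] at h ⊢
      exact Or.inr (Or.inr ⟨y, rfl, maxmin_of_ne hr hy, h⟩)
  have hle : ∀ z, (if z ∈ B then 0 else G.modVal t.rel z) ≤ G.modVal t.rel z := fun z => by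
    split_ifs
    exacts [F.nonneg z, le_rfl]
  have : IsSuper (G.modified t.rel) fun z => if z ∈ B then 0 else G.modVal t.rel z := by
    refine ⟨fun z => by split_ifs; exacts [le_rfl, F.nonneg z], ?_, ?_, ?_, ?_⟩
    · rintro (x | i) hz
      · have hx : G.kind x = .sink := hz
        rw [if_neg fun h => ?_]
        · exact (F.sink (.inl x) hz).ge
        · rcases hBinl x h with rfl | ⟨h | h, -⟩
          · exact absurd (hx.symm.trans ρ.2) (by decide)
          · exact absurd (hx.symm.trans h) (by decide)
          · exact absurd (hx.symm.trans h) (by decide)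
      · cases hz
    · rintro (x | i) hz
      · have hx : G.kind x = .ran := hz
        by_cases hxρ : x = ρ.1
        · rw [sum_modified_prob, if_pos (show (.inl x : V ⊕ G.Ran) ∈ B from Or.inl (by rw [hxρ]))]
          refine le_of_eq (Finset.sum_eq_zero fun y _ => ?_)
          by_cases hy : G.prob x y = 0
          · simp [hy]
          · obtain ⟨h1, h2⟩ := hρ y (hxρ ▸ hy)
            rw [if_pos (hBred y h1 h2), mul_zero]
        · rw [if_neg fun h => ?_, F.ran (.inl x) hz]
          · refine Finset.sum_le_sum fun y _ => mul_le_mul_of_nonneg_left (hle y) ?_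
            exact_mod_cast (G.modified t.rel).prob_nonneg (.inl x) y hz
          · rcases hBinl x h with h | ⟨h | h, -⟩
            · exact hxρ h
            · exact absurd (hx.symm.trans h) (by decide)
            · exact absurd (hx.symm.trans h) (by decide)
      · cases hz
    · rintro (x | i) w hz hw
      · have hx : G.kind x = .max := hz
        by_cases hB : (.inl x : V ⊕ G.Ran) ∈ B
        · obtain ⟨y, hy, rfl⟩ := id hw
          rcases hBinl x hB with rfl | ⟨-, h⟩
          · exact absurd (hx.symm.trans ρ.2) (by decide)
          · rw [if_pos hB, if_pos (hBred y (harc x y (Or.inl hx) hy)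
              ((forcing_value_le hx hy).trans h))]
        · rw [if_neg hB]
          exact (hle w).trans (F.max_le (.inl x) w hz hw)
      · cases hz
    · intro z hz
      by_cases hB : z ∈ B
      · suffices ∃ w, (G.modified t.rel).arc z w ∧ w ∈ B by
          obtain ⟨w, hw, hwB⟩ := this
          exact ⟨w, hw, by rw [if_pos hwB, if_pos hB]⟩
        rcases z with x | j
        · have hx : G.kind x = .min := hz
          refine ⟨G.redirect (τ ⟨x, hx⟩), ⟨_, (τ ⟨x, hx⟩).2, rfl⟩, ?_⟩
          refine hBred _ (harc x _ (Or.inr hx) (τ ⟨x, hx⟩).2) ?_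
          rcases hBinl x hB with rfl | ⟨-, h⟩
          · exact absurd (hx.symm.trans ρ.2) (by decide)
          · rwa [forcing_value_min hτ]
        · by_cases hj : ρ = j
          · exact ⟨.inl ρ.1, Or.inl (by rw [hj]), Or.inl rfl⟩
          · exact ⟨.inr ρ, Or.inr ⟨ρ, hj, t.rank_le_iff.1 ((hBinr j).1 hB), rfl⟩,
              (hBinr ρ).2 le_rfl⟩
      · obtain ⟨w, hw, he⟩ := F.min_ex z hz
        refine ⟨w, hw, ?_⟩
        rw [if_neg hB, ← he]
        exact hle w
  refine le_antisymm ((this.value_le _).trans ?_) (F.nonneg _)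
  rw [if_pos ((hBinr ρ).2 le_rfl)]

/-- In `G[t]`, a forcing strategy of max ensures `forcedVal`. The danger is a trap on which
`forcedVal` is positive; but then min could keep returning to the control node of greatest rank in
the trap, against every strategy of max. -/
theorem forcedVal_le_val (hσ : IsMaxOptimal (liftMax t σ)) (hτ : IsMinOptimal (liftMin t τ))
    (τ' : (G.modified t.rel).MinStrategy) (z : V ⊕ G.Ran) :
    G.forcedVal t z ≤ val (redirectMax t σ) τ' z := by
  classical
  have F := isOptimalityFixpoint_modVal hG t.rel
  refine le_val_of_sub' (sinksNonneg_modified hG t.rel) ?_ ?_ ?_ ?_ ?_ z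
  · rintro (x | i) hz
    · rw [forcedVal_sink (G := G) hz]
      exact (F.sink (.inl x) hz).le
    · cases hz
  · rintro (x | i) hz
    · have hx : G.kind x = .max := hz
      change _ ≤ G.forcedVal t (G.redirect (σ ⟨x, hx⟩))
      rw [forcedVal_redirect hG (harc x _ (Or.inl hx) (σ ⟨x, hx⟩).2),
        forcedVal_of_maxmin (Or.inl hx), forcing_value_max hσ]
    · cases hz
  · intro z hz
    have h := (τ' ⟨z, hz⟩).2
    generalize ((τ' ⟨z, hz⟩ : {y // _}) : V ⊕ G.Ran) = w at h
    rcases z with x | i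
    · have hx : G.kind x = .min := hz
      obtain ⟨y, hy, rfl⟩ := h
      rw [forcedVal_redirect hG (harc x _ (Or.inr hx) hy), forcedVal_of_maxmin (Or.inr hx)]
      exact rankVal_mono (le_forcing_value hx hy)
    · rcases h with rfl | ⟨j, hj, hij, rfl⟩
      · rw [forcedVal_ran i.2]
        exact modVal_le_ran hG t.rel i
      · exact modVal_le_of_rel hG hj hij
  · rintro (x | i) hz
    · rw [forcedVal_ran (G := G) hz, F.ran (.inl x) hz]
      refine Finset.sum_le_sum fun y _ => mul_le_mul_of_nonneg_left
        (modVal_le_forcedVal hG harc hτ y) ?_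
      exact_mod_cast (G.modified t.rel).prob_nonneg (.inl x) y hz
    · cases hz
  · intro A M hM hne hA hv
    -- The successors of the random nodes of the trap, in terms of `G`.
    have hsucc : ∀ x, (.inl x : V ⊕ G.Ran) ∈ A → G.kind x = .ran → ∀ y, G.prob x y ≠ 0 →
        G.kind y ≠ .sink ∧ G.redirect y ∈ A := by
      intro x hxA hx y hy
      have h1 : G.redirect y ∈ A := by
        refine hA.ran_mem hxA hx ?_
        rcases G.redirect_eq y with ⟨i, rfl, h⟩ | ⟨h, h'⟩
        · rw [h]
          exact hy
        · rw [h']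
          change (if G.kind y = .ran then 0 else G.prob x y) ≠ 0
          rwa [if_neg h]
      refine ⟨fun h => (hA _ h1).1 ?_, h1⟩
      rw [redirect_of_ne (by simp [h])]
      exact h
    by_cases hC : ∃ i, .inr i ∈ A
    · obtain ⟨i₀, hi₀⟩ := hC
      obtain ⟨ρ, hρA, hmax⟩ := Finset.exists_max_image
        (Finset.univ.filter fun i : G.Ran => .inr i ∈ A) t.rank ⟨i₀, by simpa using hi₀⟩
      simp only [Finset.mem_filter, Finset.mem_univ, true_and] at hρA hmax
      have hf : ∀ z ∈ A, (G.forcingGame t).value z ≤ t.rank ρ := fun z hz =>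
        forcing_value_le_of_isTrap hσ hA (Nat.cast_nonneg _)
          (fun i hi => by exact_mod_cast hmax i hi) hz
      have hρ : (.inl ρ.1 : V ⊕ G.Ran) ∈ A := by
        have h1 := hA.min_mem hρA (rfl : (G.modified t.rel).kind (.inr ρ) = .min)
        rcases (τ' ⟨.inr ρ, rfl⟩).2 with h | ⟨j, hj, hij, h⟩
        · rwa [h] at h1
        · rw [h] at h1
          exact absurd (t.rank_lt hij hj.symm) (not_lt.2 (hmax j h1))
      have h0 := modVal_eq_zero_of_return hG harc hτ ρ fun y hy =>
        ⟨(hsucc _ hρ ρ.2 y hy).1, hf _ (hsucc _ hρ ρ.2 y hy).2⟩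
      have h1 : G.modVal t.rel (.inr ρ) = M := hv _ hρA
      exact hM.ne' (h1.symm.trans h0)
    · push Not at hC
      have hmm : ∀ x, (.inl x : V ⊕ G.Ran) ∈ A → ¬ (G.kind x = .max ∨ G.kind x = .min) := by
        intro x hx h
        have h1 := forcing_value_le_of_isTrap hσ hA le_rfl (fun i hi => absurd hi (hC i)) hx
        have h2 := hv _ hx
        rw [forcedVal_of_maxmin h] at h2
        have h3 := rankVal_mono (G := G) (t := t) h1
        rw [rankVal_zero, h2] at h3
        exact absurd h3 (not_le.2 hM)
      obtain ⟨x | i, hz⟩ := hne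
      · have hx : G.kind x = .ran := by
          by_contra h
          exact hmm x hz (maxmin_of_ne h (hA _ hz).1)
        obtain ⟨y, -, hy⟩ := Finset.exists_ne_zero_of_sum_ne_zero
          ((G.prob_sum x hx).trans_ne one_ne_zero)
        obtain ⟨h1, h2⟩ := hsucc x hz hx y hy
        rcases G.redirect_eq y with ⟨i, -, h⟩ | ⟨h, h'⟩
        · exact hC i (h ▸ h2)
        · exact hmm y (h' ▸ h2) (maxmin_of_ne h h1)
      · exact hC i hz

omit harc in
/-- Without jumps between control nodes, the modified game is the original one. -/
theorem val_redirect_le (σ : G.MaxStrategy) (τ : G.MinStrategy) (x : V) :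
    val (redirectMax t σ) (redirectMin t τ) (.inl x) ≤ val σ τ x := by
  let h : V ⊕ G.Ran → ℝ := Sum.elim (val σ τ) fun i => val σ τ i.1
  have hred : ∀ y, h (G.redirect y) = val σ τ y := fun y => by
    rcases G.redirect_eq y with ⟨i, rfl, hi⟩ | ⟨-, hi⟩ <;> rw [hi] <;> rfl
  refine val_le_of_super' (redirectMax t σ) (redirectMin t τ) (w := h) ?_ ?_ ?_ ?_ ?_ (.inl x)
  · rintro (x | i) <;> exact val_nonneg σ τ hG _
  · rintro (x | i) hz
    · exact (val_sink σ τ hz).ge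
    · cases hz
  · rintro (x | i) hz
    · exact ((hred _).trans (val_max σ τ hz).symm).le
    · cases hz
  · rintro (x | i) hz
    · exact ((hred _).trans (val_min σ τ hz).symm).le
    · exact le_rfl
  · rintro (x | i) hz
    · rw [sum_modified_prob]
      simp_rw [hred]
      exact (val_ran σ τ hz).ge
    · cases hz

/-- If no control node of `G[t]` is constrained, then `t`-forcing strategies are optimal in `G`. -/
theorem areOptimal_of_areForcing (ht : ∀ i, ¬ G.IsConstrained t i) (h : AreForcing t σ τ) :
    AreOptimal σ τ := by
  obtain ⟨hσ, hτ⟩ := h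
  have F := isOptimalityFixpoint_modVal hG t.rel
  have hi : ∀ i : G.Ran, G.modVal t.rel (.inr i) = G.modVal t.rel (.inl i.1) := fun i =>
    le_antisymm (modVal_le_ran hG t.rel i) (not_lt.1 (ht i))
  have hred : ∀ y, G.modVal t.rel (G.redirect y) = G.modVal t.rel (.inl y) := fun y => by
    rcases G.redirect_eq y with ⟨i, rfl, h⟩ | ⟨-, h⟩ <;> rw [h]
    exact hi i
  have hval : ∀ z, G.forcedVal t z = G.modVal t.rel z := fun z => by
    refine le_antisymm ?_ (modVal_le_forcedVal hG harc hτ z)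
    exact (le_ciInf fun τ' => forcedVal_le_val hG harc hσ hτ τ' z).trans (valMax_le_value _ z)
  refine (areOptimal_of_saddle (v := fun x => G.modVal t.rel (.inl x)) (fun τ' x => ?_)
    fun σ' => ?_).1
  · rw [← hval]
    exact (forcedVal_le_val hG harc hσ hτ (redirectMin t τ') (.inl x)).trans
      (val_redirect_le hG σ τ' x)
  · refine val_le_of_super' σ' τ (fun x => F.nonneg _) (fun x hx => (F.sink (.inl x) hx).ge)
      (fun x hx => ?_) (fun x hx => ?_) (fun x hx => ?_)
    · rw [← hred]
      exact F.max_le (.inl x) _ hx ⟨_, (σ' ⟨x, hx⟩).2, rfl⟩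
    · rw [← hred, ← hval, ← hval, forcedVal_redirect hG (harc x _ (Or.inr hx) (τ ⟨x, hx⟩).2),
        forcedVal_of_maxmin (Or.inr hx), forcing_value_min hτ]
    · rw [F.ran (.inl x) hx, sum_modified_prob]
      simp_rw [hred]
      exact le_rfl

end Forcing

end SSG

end

open Classical in
theorem mainTheorem1 {V : Type*} [Fintype V] (G : SSG V) (hG : G.IsCanonical)
    (hval : ∀ x, G.kind x = .sink → 0 ≤ G.sinkVal x) (t : TotalOrder G.Ran) :
    ∃ N : PairOrder G.Ran → ℕ,
      (∀ Θ, ∃ σ τ, SSG.Returns Θ t (N Θ) σ τ) ∧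
      (∀ Θ n σ τ, SSG.Returns Θ t n σ τ → n = N Θ ∧ SSG.AreOptimal σ τ) ∧
      (∑ Θ, (N Θ : ℝ)) / Fintype.card (PairOrder G.Ran) ≤
        Real.exp (√2 * Fintype.card G.Ran) := by
  obtain ⟨N, hN, hbound⟩ := SSG.exists_run hval t
  refine ⟨N, fun Θ => ?_, fun Θ n σ τ ⟨t', hrun, hf⟩ => ?_, hbound⟩
  · obtain ⟨t', hrun⟩ := hN Θ
    obtain ⟨σ, τ, hf⟩ := SSG.exists_areForcing t'
    exact ⟨σ, τ, t', hrun, hf⟩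
  · obtain ⟨t'', hrun'⟩ := hN Θ
    exact ⟨(hrun.unique hrun').1,
      SSG.areOptimal_of_areForcing hval hG.2 hrun.not_isConstrained hf⟩
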